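/- Setting. Let $m,n,d$ be dimensions, $S$ a Polish space (with a fixed complete separable metric), $\pi$ a probability measure on $S$, $\lambda$ Lebesgue measure on $\mathbb R^m$, and $(\Omega,\mathcal F,P)$ a probability space; $\|\cdot\|$ is the Euclidean norm on vectors and the Frobenius norm on matrices. Let $L=\{L(B): B\subset S\times\mathbb R^m \text{ bounded Borel}\}$ be an $\mathbb R^d$-valued Lévy basis with characteristic quadruplet $(\gamma,\Sigma,\nu,\pi)$. This means: each $L(B)$ is an infinitely divisible random vector; $L(B_1),\dots,L(B_k)$ are independent for pairwise disjoint $B_1,\dots,B_k$; $L(\bigcup_i B_i)=\sum_i L(B_i)$ a.s. for pairwise disjoint $B_i$ with bounded union; and $$E\,e^{i\langle u,L(B)\rangle}=e^{\Phi(u)(\pi\otimes\lambda)(B)},\qquad \Phi(u)=i\langle\gamma,u\rangle-\tfrac12\langle u,\Sigma u\rangle+\int_{\mathbb R^d}\bigl(e^{i\langle u,x\rangle}-1-i\langle u,x\rangle \mathbf 1_{\{\|x\|\le1\}}\bigr)\nu(dx),$$ where $\gamma\in\mathbb R^d$, $\Sigma$ is symmetric positive semidefinite and $\nu$ is a Lévy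 measure on $\mathbb R^d$. For an $\mathbb R^n$-valued field $X=(X_t)_{t\in\mathbb R^m}$ and $h\ge 0$ put $$\eta(h)=\sup_{u,v\ge1}\ \sup\frac{|\mathrm{Cov}(F(X_\Gamma),G(X_{\tilde\Gamma}))|}{u\|G\|_\infty \mathrm{Lip}(F)+v\|F\|_\infty \mathrm{Lip}(G)},$$ the inner supremum being over bounded Lipschitz $F:(\mathbb R^n)^u\to\mathbb R$ and $G:(\mathbb R^n)^v\to\mathbb R$ (with respect to $\sum_i\|x_i-y_i\|$, and with $0/0=0$) and over $\Gamma,\tilde\Gamma\subset\mathbb R^m$ consisting of $u$ and $v$ distinct points, respectively, at distance at least $h$ from each other in the maximum norm. $X$ is called $\eta$-weakly dependent if $\eta(h)\to0$ as $h\to\infty$. Its $\eta$-coefficients decay exponentially if there are $C\ge0$, $c>0$ with $\eta(h)\le Ce^{-ch}$ for all $h\ge0$. Theorem. Assume that $\int_{\|x\|>1}\|x\|^2\,\nu(dx)<\infty$ and $\gamma+\int_{\|x\|>1}x\,\nu(dx)=0$. Let $g:\mathbb R^m\to M_{n\times d}(\mathbb R)$ be Borel measurable, and suppose that there are $M\ge0$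 and $K>0$ such that $$\|g(t)\|^2\le M e^{-K\|t\|}\qquad\text{for all } t\in\mathbb R^m .$$ Then for every $t\in\mathbb R^m$ the kernel $(A,s)\mapsto g(t-s)$ is $L$-integrable in the sense of Rajput and Rosiński, and the moving average field $X_t=\int g(t-s)\,L(ds)$, $t\in\mathbb R^m$, is $\eta$-weakly dependent with exponentially decaying $\eta$-coefficients. In particular, the same conclusion holds for the following kernels, which include those of Lévy-driven CARMA fields (the case $n=d=1$): (a) causal kernels $g(t)=B\,e^{A_1t_1}\cdots e^{A_mt_m}\,C\,\mathbf 1_{[0,\infty)^m}(t)$ with real $p\times p$ matrices $A_1,\dots,A_m$ all of whose complex eigenvalues have negative real part, $B\in M_{n\times p}(\mathbb R)$ and $C\in M_{p\times d}(\mathbb R)$ (for causal CARMA fields the $A_k$ are companion matrices and $C=(0,\dots,0,1)^T$); (b) isotropic kernels $g(t)=\mathrm{Re}\sum_{r=1}^p c_r e^{z_r\|t\|}$ with $c_r\in M_{n\times d}(\mathbb C)$, $z_r\in\mathbb C$ and $\mathrm{Re}\,z_r<0$. -/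

import Mathlib

open MeasureTheory ProbabilityTheory Filter Topology
open scoped ENNReal

noncomputable section

namespace LevyField

/-- `ℝᵏ` with the Euclidean norm. -/
abbrev RSpace (k : ℕ) : Type := EuclideanSpace ℝ (Fin k)

/-! ### Infinitely divisible laws and Lévy bases -/

/-- `ρ` is infinitely divisible: for every `k ≥ 1` it is the law of a sum of `k` independent,
identically distributed random vectors. -/
def IsInfinitelyDivisible {d : ℕ} (ρ : Measure (RSpace d)) : Prop :=
  ∀ k : ℕ, 1 ≤ k → ∃ ρk : Measure (RSpace d), IsProbabilityMeasure ρk ∧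
    (Measure.pi fun _ : Fin k => ρk).map (fun x => ∑ i, x i) = ρ

/-- `ν` is a Lévy measure: no mass at the origin and `∫ (1 ∧ ‖x‖²) ν(dx) < ∞`. -/
def IsLevyMeasure {d : ℕ} (ν : Measure (RSpace d)) : Prop :=
  ν {0} = 0 ∧ ∫⁻ x, ENNReal.ofReal (min 1 (‖x‖ ^ 2)) ∂ν < ∞

/-- The cumulant transform (Lévy–Khintchine exponent) of the triplet `(γ, Σ, ν)`:
`Φ(u) = i⟨γ,u⟩ - ⟨u,Σu⟩/2 + ∫ (exp(i⟨u,x⟩) - 1 - i⟨u,x⟩ 1_{‖x‖ ≤ 1}) ν(dx)`. -/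
def cumulant {d : ℕ} (γ : RSpace d) (Sig : Matrix (Fin d) (Fin d) ℝ) (ν : Measure (RSpace d))
    (u : RSpace d) : ℂ :=
  Complex.I * ((inner ℝ γ u : ℝ) : ℂ)
    - (1 / 2 : ℂ) * ((u.ofLp ⬝ᵥ (Sig.mulVec u.ofLp) : ℝ) : ℂ)
    + ∫ x, (Complex.exp (Complex.I * ((inner ℝ u x : ℝ) : ℂ)) - 1
        - (if ‖x‖ ≤ 1 then Complex.I * ((inner ℝ u x : ℝ) : ℂ) else 0)) ∂ν

/-- A bounded Borel set. -/
def IsBddBorel {T : Type*} [Bornology T] [MeasurableSpace T] (B : Set T) : Prop :=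
  Bornology.IsBounded B ∧ MeasurableSet B

/-- The family `(L(B))`, `B` ranging over the bounded Borel sets of `S × ℝᵐ`, is an `ℝᵈ`-valued
Lévy basis (infinitely divisible independently scattered random measure). The values of `L` at
other sets are irrelevant. In (iii) the series is a limit of partial sums. -/
structure IsLevyBasis {Ω S : Type*} [MeasurableSpace Ω] [MetricSpace S] [MeasurableSpace S]
    {m d : ℕ} (P : Measure Ω) (L : Set (S × RSpace m) → Ω → RSpace d) : Prop where
  /-- each `L(B)` is a random vector -/
  aemeasurable : ∀ B, IsBddBorel B → AEMeasurable (L B) P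
  /-- (i) the law of each `L(B)` is infinitely divisible -/
  infDivisible : ∀ B, IsBddBorel B → IsInfinitelyDivisible (P.map (L B))
  /-- (ii) the values on finitely many pairwise disjoint sets are independent -/
  independent : ∀ (k : ℕ) (B : Fin k → Set (S × RSpace m)), (∀ i, IsBddBorel (B i)) →
    Pairwise (Function.onFun Disjoint B) → iIndepFun (fun i => L (B i)) P
  /-- (iii) countable additivity, almost surely -/
  sigmaAdditive : ∀ B : ℕ → Set (S × RSpace m), (∀ i, IsBddBorel (B i)) →
    Pairwise (Function.onFun Disjoint B) → IsBddBorel (⋃ i, B i) →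
    ∀ᵐ ω ∂P, Tendsto (fun N => ∑ i ∈ Finset.range N, L (B i) ω) atTop (𝓝 (L (⋃ i, B i) ω))

/-- `L` is homogeneous and factorisable with characteristic quadruplet `(γ, Σ, ν, π)`: `Σ` is
symmetric positive semidefinite, `ν` is a Lévy measure, `π` is a probability measure on `S`, and
`E exp(i⟨u, L(B)⟩) = exp(Φ(u) (π × λ)(B))` for all bounded Borel sets `B`, with `λ` the Lebesgue
measure on `ℝᵐ`. -/
structure HasCharacteristicQuadruplet {Ω S : Type*} [MeasurableSpace Ω] [MetricSpace S]
    [MeasurableSpace S] {m d : ℕ} (P : Measure Ω) (L : Set (S × RSpace m) → Ω → RSpace d)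
    (γ : RSpace d) (Sig : Matrix (Fin d) (Fin d) ℝ) (ν : Measure (RSpace d)) (π : Measure S) :
    Prop where
  posSemidef : Sig.PosSemidef
  isLevyMeasure : IsLevyMeasure ν
  isProbabilityMeasure : IsProbabilityMeasure π
  charFun_eq : ∀ B, IsBddBorel B → ∀ u : RSpace d,
    ∫ ω, Complex.exp (Complex.I * ((inner ℝ u (L B ω) : ℝ) : ℂ)) ∂P
      = Complex.exp (cumulant γ Sig ν u * (((π.prod volume).real B : ℝ) : ℂ))

/-! ### Stochastic integration of matrix-valued kernels (Rajput–Rosiński) -/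

/-- The action of an `n × d` matrix on a vector of `ℝᵈ`. -/
def matVec {n d : ℕ} (A : Matrix (Fin n) (Fin d) ℝ) (x : RSpace d) : RSpace n :=
  WithLp.toLp 2 (A.mulVec x.ofLp)

/-- A simple kernel `∑ⱼ aⱼ 1_{Bⱼ}` with matrices `aⱼ` and pairwise disjoint bounded Borel `Bⱼ`. -/
structure SimpleKernel (T : Type*) [Bornology T] [MeasurableSpace T] (n d : ℕ) where
  size : ℕ
  coeff : Fin size → Matrix (Fin n) (Fin d) ℝ
  sets : Fin size → Set T
  bddBorel : ∀ j, IsBddBorel (sets j)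
  disjoint : Pairwise (Function.onFun Disjoint sets)

/-- The function `∑ⱼ aⱼ 1_{Bⱼ}`. -/
def SimpleKernel.toFun {T : Type*} [Bornology T] [MeasurableSpace T] {n d : ℕ}
    (φ : SimpleKernel T n d) (p : T) : Matrix (Fin n) (Fin d) ℝ :=
  ∑ j, (φ.sets j).indicator (fun _ => φ.coeff j) p

/-- The integral `∫_A φ dL = ∑ⱼ aⱼ L(A ∩ Bⱼ)` of a simple kernel. -/
def SimpleKernel.integral {Ω T : Type*} [Bornology T] [MeasurableSpace T] {n d : ℕ}
    (φ : SimpleKernel T n d) (L : Set T → Ω → RSpace d) (A : Set T) (ω : Ω) : RSpace n :=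
  ∑ j, matVec (φ.coeff j) (L (A ∩ φ.sets j) ω)

/-- `Y = ∫ f dL` almost surely, as an integral in the sense of Rajput and Rosiński: the Borel
function `f` is the almost everywhere limit of simple kernels `φₖ` such that `∫_A φₖ dL` converges
in probability for every Borel set `A`, and `Y` is the limit in probability of `∫ φₖ dL`.
Here "almost everywhere" refers to `Π = π × λ`. -/
def IsStochasticIntegral {Ω S : Type*} [MeasurableSpace Ω] [MetricSpace S] [MeasurableSpace S]
    {m d n : ℕ} (P : Measure Ω) (π : Measure S) (L : Set (S × RSpace m) → Ω → RSpace d)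
    (f : S × RSpace m → Matrix (Fin n) (Fin d) ℝ) (Y : Ω → RSpace n) : Prop :=
  (∀ i j, Measurable fun p => f p i j) ∧ AEMeasurable Y P ∧
  ∃ φ : ℕ → SimpleKernel (S × RSpace m) n d,
    (∀ᵐ p ∂(π.prod (volume : Measure (RSpace m))),
      Tendsto (fun k => (φ k).toFun p) atTop (𝓝 (f p))) ∧
    (∀ A : Set (S × RSpace m), MeasurableSet A → ∃ YA : Ω → RSpace n, AEMeasurable YA P ∧
      TendstoInMeasure P (fun k => (φ k).integral L A) atTop YA) ∧
    TendstoInMeasure P (fun k => (φ k).integral L Set.univ) atTop Y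

/-- `f` is `L`-integrable in the sense of Rajput and Rosiński. -/
def IsLevyIntegrable {Ω S : Type*} [MeasurableSpace Ω] [MetricSpace S] [MeasurableSpace S]
    {m d n : ℕ} (P : Measure Ω) (π : Measure S) (L : Set (S × RSpace m) → Ω → RSpace d)
    (f : S × RSpace m → Matrix (Fin n) (Fin d) ℝ) : Prop :=
  ∃ Y : Ω → RSpace n, IsStochasticIntegral P π L f Y

/-- The kernel `(A, s) ↦ g(t - s)` on `S × ℝᵐ`. -/
def shiftedKernel (S : Type*) {m d n : ℕ} (g : RSpace m → Matrix (Fin n) (Fin d) ℝ)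
    (t : RSpace m) (p : S × RSpace m) : Matrix (Fin n) (Fin d) ℝ :=
  g (t - p.2)

/-- `X` is (a version of) the moving average field `X_t = ∫ g(t - s) L(ds)`, `t ∈ ℝᵐ`. -/
def IsMovingAverageField {Ω S : Type*} [MeasurableSpace Ω] [MetricSpace S] [MeasurableSpace S]
    {m d n : ℕ} (P : Measure Ω) (π : Measure S) (L : Set (S × RSpace m) → Ω → RSpace d)
    (g : RSpace m → Matrix (Fin n) (Fin d) ℝ) (X : RSpace m → Ω → RSpace n) : Prop :=
  ∀ t, IsStochasticIntegral P π L (shiftedKernel S g t) (X t)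

/-! ### `η`-weak dependence -/

/-- `‖F‖_∞`, with value in `[0, ∞]`. -/
def supNorm {n u : ℕ} (F : (Fin u → RSpace n) → ℝ) : ℝ≥0∞ :=
  ⨆ x, ‖F x‖ₑ

/-- `Lip(F) = sup_{x ≠ y} |F(x) - F(y)| / ∑ᵢ ‖xᵢ - yᵢ‖`, with value in `[0, ∞]`
(pairs with `x = y` contribute `0 / 0 = 0`). -/
def lipConst {n u : ℕ} (F : (Fin u → RSpace n) → ℝ) : ℝ≥0∞ :=
  ⨆ x, ⨆ y, ‖F x - F y‖ₑ / ∑ i, ‖x i - y i‖ₑ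

/-- The class `𝒢_u` of bounded, Lipschitz continuous functions `(ℝⁿ)ᵘ → ℝ`. -/
def BddLipschitz (n u : ℕ) : Set ((Fin u → RSpace n) → ℝ) :=
  {F | supNorm F < ∞ ∧ lipConst F < ∞}

/-- `Γ` and `Γ'` enumerate sets of distinct points at distance at least `h` with respect to the
maximum norm on `ℝᵐ` (the norm of `Fin m → ℝ`). -/
def SeparatedBy {m u v : ℕ} (h : ℝ) (Γ : Fin u → RSpace m) (Γ' : Fin v → RSpace m) : Prop :=
  Function.Injective Γ ∧ Function.Injective Γ' ∧
    ∀ a b, h ≤ ‖(Γ a).ofLp - (Γ' b).ofLp‖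

/-- `η_{u,v}(h)`, the supremum of
`|Cov(F(X_Γ), G(X_Γ'))| / (u ‖G‖_∞ Lip(F) + v ‖F‖_∞ Lip(G))`, with value in `[0, ∞]`. -/
def etaUV {Ω : Type*} [MeasurableSpace Ω] {m n : ℕ} (P : Measure Ω) (X : RSpace m → Ω → RSpace n)
    (u v : ℕ) (h : ℝ) : ℝ≥0∞ :=
  ⨆ F ∈ BddLipschitz n u, ⨆ G ∈ BddLipschitz n v,
    ⨆ (Γ : Fin u → RSpace m) (Γ' : Fin v → RSpace m) (_ : SeparatedBy h Γ Γ'),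
      ‖cov[fun ω => F fun a => X (Γ a) ω, fun ω => G fun b => X (Γ' b) ω; P]‖ₑ /
        ((u : ℝ≥0∞) * supNorm G * lipConst F + (v : ℝ≥0∞) * supNorm F * lipConst G)

/-- The `η`-coefficients `η(h) = sup_{u,v ≥ 1} η_{u,v}(h)`, with value in `[0, ∞]`. -/
def eta {Ω : Type*} [MeasurableSpace Ω] {m n : ℕ} (P : Measure Ω) (X : RSpace m → Ω → RSpace n)
    (h : ℝ) : ℝ≥0∞ :=
  ⨆ (u : ℕ) (_ : 1 ≤ u) (v : ℕ) (_ : 1 ≤ v), etaUV P X u v h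

/-- `X` is `η`-weakly dependent. -/
def IsEtaWeaklyDependent {Ω : Type*} [MeasurableSpace Ω] {m n : ℕ} (P : Measure Ω)
    (X : RSpace m → Ω → RSpace n) : Prop :=
  Tendsto (eta P X) atTop (𝓝 0)

/-- The `η`-coefficients of `X` decay exponentially: `η(h) ≤ C exp(-c h)` for all `h ≥ 0`. -/
def HasExpDecayingEta {Ω : Type*} [MeasurableSpace Ω] {m n : ℕ} (P : Measure Ω)
    (X : RSpace m → Ω → RSpace n) : Prop :=
  ∃ C c : ℝ, 0 < c ∧ ∀ h : ℝ, 0 ≤ h → eta P X h ≤ ENNReal.ofReal (C * Real.exp (-c * h))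

/-- The kernel `g(t - ·)` is `L`-integrable for every `t`, and (every version of) the moving
average field with kernel `g` is `η`-weakly dependent with exponentially decaying
`η`-coefficients. -/
def MovingAverageIsExpEta {Ω S : Type*} [MeasurableSpace Ω] [MetricSpace S] [MeasurableSpace S]
    {m d n : ℕ} (P : Measure Ω) (π : Measure S) (L : Set (S × RSpace m) → Ω → RSpace d)
    (g : RSpace m → Matrix (Fin n) (Fin d) ℝ) : Prop :=
  (∀ t, IsLevyIntegrable P π L (shiftedKernel S g t)) ∧
  ∀ X : RSpace m → Ω → RSpace n, IsMovingAverageField P π L g X →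
    IsEtaWeaklyDependent P X ∧ HasExpDecayingEta P X

/-! ### Kernels -/

/-- The Frobenius norm `√(tr(A Aᵀ))`. -/
def frobNorm {n d : ℕ} (A : Matrix (Fin n) (Fin d) ℝ) : ℝ :=
  √(A * A.transpose).trace

open Classical in
/-- The causal kernel `t ↦ B e^{A₁t₁} ⋯ e^{Aₘtₘ} C` on `[0,∞)ᵐ`, zero elsewhere. For `n = d = 1`,
companion matrices `Aₖ`, `B = bᵀ` and `C = (0,…,0,1)ᵀ` it is the kernel of a causal CARMA field. -/
def causalKernel {m n d p : ℕ} (A : Fin m → Matrix (Fin p) (Fin p) ℝ)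
    (B : Matrix (Fin n) (Fin p) ℝ) (C : Matrix (Fin p) (Fin d) ℝ) (t : RSpace m) :
    Matrix (Fin n) (Fin d) ℝ :=
  if ∀ k, 0 ≤ t k then
    B * (List.ofFn fun k => NormedSpace.exp (t k • A k)).prod * C
  else 0

/-- The isotropic kernel `t ↦ Re ∑ᵣ cᵣ e^{zᵣ‖t‖}`. For `n = d = 1` and suitable `cᵣ`, `zᵣ` it is
the kernel of an isotropic CARMA field. -/
def isotropicKernel {m n d p : ℕ} (c : Fin p → Matrix (Fin n) (Fin d) ℂ) (z : Fin p → ℂ)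
    (t : RSpace m) : Matrix (Fin n) (Fin d) ℝ :=
  Matrix.of fun i j => (∑ r, c r i j * Complex.exp (z r * ((‖t‖ : ℝ) : ℂ))).re

end LevyField

end

/-!
The integral `X t = ∫ g(t - s) L(ds)` is compared with the integral of the same kernel over the set
of points whose spatial coordinate lies within `h / 2` of `t` in the maximum norm. For two families
of points at distance at least `h` these sets are disjoint, so the truncated fields are independent,
and the covariance of Lipschitz functionals of the two families is at most a multiple of the
truncation error in mean (`eta_le_of_exists_indepFun`). That error is at most a constant times the
square root of `∫ ‖g(s)‖² ds` over `‖s‖ ≥ h / 2`, which is exponentially small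
(`movingAverageIsExpEta_of_frobSq_le`).

Everything about the Lévy basis is read off characteristic functions. Cutting finitely many sets
into atoms gives the joint characteristic function of integrals of simple kernels `φₐ`, namely
`exp (∫ Φ(∑ₐ φₐᵀ uₐ) d(π × λ))` (`integral_exp_sum_inner_integral_eq`). Because the triplet is
centred and has second moments, `Φ` has nonpositive real part and `|Φ(u)| ≤ K‖u‖²`
(`exists_norm_cumulant_le`). Independence over disjoint sets follows from additivity of the exponent
(`indepFun_integral_of_disjoint`), and the quadratic bound yields by Fatou's lemma the estimate
`E‖∫ φ dL‖² ≤ K ∫ ‖φ‖²` (`exists_lintegral_sq_norm_sub_le`), hence existence of the integral of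
every square integrable kernel as an `L²`-limit (`exists_tendsto_stochasticIntegral`).

The definition of the stochastic integral admits arbitrary approximating simple kernels, which need
not converge in `L²`, so its value has to be shown independent of them
(`IsStochasticIntegral.ae_eq`). For two approximating sequences the exponents
`hₖ = Φ((φₖ - ψₖ)ᵀ u)` tend to `0` almost everywhere while `exp (∫_A hₖ)` converges for every
measurable `A`; a gliding hump argument then gives `exp (∫ hₖ) → 1` (`tendsto_exp_integral_one`).

The causal kernels decay exponentially because `‖exp (t A)‖` does when all eigenvalues of `A` have
negative real part, by Gelfand's formula for `exp A` (`exists_norm_exp_smul_le_of_spectrum`). For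
the isotropic kernels the bound is immediate.
-/

namespace LevyField

/-! ### The cumulant transform -/

lemma norm_exp_I_sub_one_sub_le (x : ℝ) :
    ‖Complex.exp (Complex.I * x) - 1 - Complex.I * x‖ ≤ 2 * x ^ 2 := by
  have hn : ‖Complex.I * (x : ℂ)‖ = |x| := by simp
  rcases le_or_gt |x| 1 with h | h
  · have := Complex.norm_exp_sub_one_sub_id_le (x := Complex.I * x) (by rw [hn]; exact h)
    rw [hn, sq_abs] at this
    nlinarith [sq_nonneg x]
  · have h1 := Real.norm_exp_I_mul_ofReal_sub_one_le (x := x)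
    have h2 := norm_sub_le (Complex.exp (Complex.I * x) - 1) (Complex.I * x)
    rw [hn] at h2
    rw [Real.norm_eq_abs] at h1
    have : |x| ^ 2 = x ^ 2 := sq_abs x
    nlinarith

lemma norm_exp_I_inner_sub_one_sub_le {d : ℕ} (u x : RSpace d) :
    ‖Complex.exp (Complex.I * ((inner ℝ u x : ℝ) : ℂ)) - 1 - Complex.I * ((inner ℝ u x : ℝ) : ℂ)‖
      ≤ 2 * ‖u‖ ^ 2 * ‖x‖ ^ 2 := by
  refine (norm_exp_I_sub_one_sub_le _).trans ?_
  have h1 := abs_real_inner_le_norm u x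
  have h2 : (inner ℝ u x : ℝ) ^ 2 ≤ (‖u‖ * ‖x‖) ^ 2 :=
    sq_le_sq' (by linarith [neg_abs_le (inner ℝ u x : ℝ)]) (le_of_abs_le h1)
  nlinarith

/-- A Lévy measure whose large jumps have a second moment has a second moment. -/
lemma integrable_sq_norm_of_isLevyMeasure {d : ℕ} {ν : Measure (RSpace d)} (hν : IsLevyMeasure ν)
    (hmoment : ∫⁻ x in {x | 1 < ‖x‖}, ENNReal.ofReal (‖x‖ ^ 2) ∂ν < ∞) :
    Integrable (fun x : RSpace d => ‖x‖ ^ 2) ν := by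
  have hms : MeasurableSet {x : RSpace d | 1 < ‖x‖} := measurableSet_lt (by fun_prop) (by fun_prop)
  refine ⟨by fun_prop, ?_⟩
  rw [hasFiniteIntegral_iff_ofReal (ae_of_all _ fun x => by positivity)]
  rw [← lintegral_add_compl _ hms]
  refine ENNReal.add_lt_top.2 ⟨hmoment, lt_of_le_of_lt ?_ hν.2⟩
  refine le_trans (setLIntegral_mono_ae (g := fun x => ENNReal.ofReal (min 1 (‖x‖ ^ 2)))
    (by fun_prop) (ae_of_all _ fun x hx => ?_)) (setLIntegral_le_lintegral _ _)
  have : ‖x‖ ≤ 1 := by simpa using hx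
  rw [min_eq_right (by nlinarith [norm_nonneg x])]

lemma integrable_exp_sub_one_sub {d : ℕ} {ν : Measure (RSpace d)}
    (hint : Integrable (fun x : RSpace d => ‖x‖ ^ 2) ν) (u : RSpace d) :
    Integrable (fun x : RSpace d => Complex.exp (Complex.I * ((inner ℝ u x : ℝ) : ℂ)) - 1
      - Complex.I * ((inner ℝ u x : ℝ) : ℂ)) ν := by
  exact (hint.const_mul (2 * ‖u‖ ^ 2)).mono' (by fun_prop)
    (ae_of_all _ fun x => norm_exp_I_inner_sub_one_sub_le u x)

/-- With a centred second-order triplet the drift and the truncation cancel. -/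
lemma cumulant_eq_of_centered {d : ℕ} {γ : RSpace d} {Sig : Matrix (Fin d) (Fin d) ℝ}
    {ν : Measure (RSpace d)} (hint : Integrable (fun x : RSpace d => ‖x‖ ^ 2) ν)
    (hcentered : γ + ∫ x in {x | 1 < ‖x‖}, x ∂ν = 0) (u : RSpace d) :
    cumulant γ Sig ν u = - (1 / 2 : ℂ) * ((u.ofLp ⬝ᵥ (Sig.mulVec u.ofLp) : ℝ) : ℂ)
      + ∫ x, (Complex.exp (Complex.I * ((inner ℝ u x : ℝ) : ℂ)) - 1
        - Complex.I * ((inner ℝ u x : ℝ) : ℂ)) ∂ν := by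
  have hms : MeasurableSet {x : RSpace d | 1 < ‖x‖} := measurableSet_lt (by fun_prop) (by fun_prop)
  have hid : IntegrableOn (fun x : RSpace d => x) {x | 1 < ‖x‖} ν := by
    refine (hint.integrableOn).mono' (by fun_prop)
      ((ae_restrict_iff' hms).2 (ae_of_all _ fun x hx => ?_))
    have : 1 < ‖x‖ := hx
    nlinarith
  have hinner : ∫ x in {x | 1 < ‖x‖}, (inner ℝ u x : ℝ) ∂ν = - inner ℝ γ u := by
    rw [integral_inner hid, eq_neg_of_add_eq_zero_right hcentered, inner_neg_right, real_inner_comm]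
  have hlarge : Integrable ({x : RSpace d | 1 < ‖x‖}.indicator
      fun x => Complex.I * ((inner ℝ u x : ℝ) : ℂ)) ν := by
    rw [integrable_indicator_iff hms]
    exact ((hid.const_inner u).ofReal).const_mul _
  have key : ∀ x : RSpace d, Complex.exp (Complex.I * ((inner ℝ u x : ℝ) : ℂ)) - 1
        - (if ‖x‖ ≤ 1 then Complex.I * ((inner ℝ u x : ℝ) : ℂ) else 0)
      = (Complex.exp (Complex.I * ((inner ℝ u x : ℝ) : ℂ)) - 1
        - Complex.I * ((inner ℝ u x : ℝ) : ℂ)) + {x : RSpace d | 1 < ‖x‖}.indicator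
          (fun x => Complex.I * ((inner ℝ u x : ℝ) : ℂ)) x := by
    intro x
    by_cases hx : ‖x‖ ≤ 1
    · simp [hx, not_lt.2 hx]
    · simp [hx, not_le.1 hx]
  rw [cumulant]
  simp_rw [key]
  rw [integral_add (integrable_exp_sub_one_sub hint u) hlarge, integral_indicator hms,
    integral_const_mul, integral_complex_ofReal, hinner]
  push_cast
  ring

/-- For a centred second-order triplet, `Φ` is of quadratic growth and has nonpositive real
part. -/
lemma exists_norm_cumulant_le {d : ℕ} {γ : RSpace d} {Sig : Matrix (Fin d) (Fin d) ℝ}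
    {ν : Measure (RSpace d)} (hSig : Sig.PosSemidef) (hν : IsLevyMeasure ν)
    (hmoment : ∫⁻ x in {x | 1 < ‖x‖}, ENNReal.ofReal (‖x‖ ^ 2) ∂ν < ∞)
    (hcentered : γ + ∫ x in {x | 1 < ‖x‖}, x ∂ν = 0) :
    ∃ K : ℝ, 0 ≤ K ∧ ∀ u, ‖cumulant γ Sig ν u‖ ≤ K * ‖u‖ ^ 2 ∧ (cumulant γ Sig ν u).re ≤ 0 := by
  have hint := integrable_sq_norm_of_isLevyMeasure hν hmoment
  let T := (Matrix.toEuclideanCLM (n := Fin d) (𝕜 := ℝ) Sig)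
  have hT : ∀ u : RSpace d, u.ofLp ⬝ᵥ (Sig.mulVec u.ofLp) = inner ℝ (T u) u := by
    intro u
    simp [T, EuclideanSpace.inner_eq_star_dotProduct]
  refine ⟨‖T‖ + 2 * ∫ x, ‖x‖ ^ 2 ∂ν, by positivity, fun u => ⟨?_, ?_⟩⟩
  · rw [cumulant_eq_of_centered hint hcentered]
    have h1 : ‖(((u.ofLp ⬝ᵥ (Sig.mulVec u.ofLp) : ℝ)) : ℂ)‖ ≤ ‖T‖ * ‖u‖ ^ 2 := by
      rw [hT, Complex.norm_real]
      calc ‖(inner ℝ (T u) u : ℝ)‖ ≤ ‖T u‖ * ‖u‖ := norm_inner_le_norm _ _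
        _ ≤ (‖T‖ * ‖u‖) * ‖u‖ := by gcongr; exact T.le_opNorm u
        _ = _ := by ring
    have h2 : ‖∫ x, (Complex.exp (Complex.I * ((inner ℝ u x : ℝ) : ℂ)) - 1
        - Complex.I * ((inner ℝ u x : ℝ) : ℂ)) ∂ν‖ ≤ ∫ x, 2 * ‖u‖ ^ 2 * ‖x‖ ^ 2 ∂ν := by
      exact norm_integral_le_of_norm_le (hint.const_mul _)
        (ae_of_all _ fun x => norm_exp_I_inner_sub_one_sub_le u x)
    rw [integral_const_mul] at h2
    refine (norm_add_le _ _).trans ?_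
    rw [norm_mul]
    have h3 : ‖(-(1 / 2) : ℂ)‖ ≤ 1 := by norm_num
    have h4 := mul_le_mul h3 h1 (norm_nonneg _) zero_le_one
    linarith
  · have hnn : 0 ≤ u.ofLp ⬝ᵥ (Sig.mulVec u.ofLp) := by
      simpa using hSig.dotProduct_mulVec_nonneg u.ofLp
    rw [cumulant_eq_of_centered hint hcentered, Complex.add_re]
    have hre : (∫ x, (Complex.exp (Complex.I * ((inner ℝ u x : ℝ) : ℂ)) - 1
        - Complex.I * ((inner ℝ u x : ℝ) : ℂ)) ∂ν).re
        = ∫ x, (Real.cos (inner ℝ u x) - 1) ∂ν := by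
      rw [← RCLike.re_eq_complex_re, ← integral_re (integrable_exp_sub_one_sub hint u)]
      congr 1; ext x
      simp [mul_comm Complex.I, Complex.exp_ofReal_mul_I_re]
    rw [hre]
    have h1 : ∫ x, (Real.cos (inner ℝ u x) - 1) ∂ν ≤ 0 :=
      integral_nonpos fun x => by simpa using Real.cos_le_one _
    have h2 : (-(1 / 2 : ℂ) * ((u.ofLp ⬝ᵥ (Sig.mulVec u.ofLp) : ℝ) : ℂ)).re
        = - (1 / 2) * (u.ofLp ⬝ᵥ (Sig.mulVec u.ofLp)) := by
      rw [Complex.re_mul_ofReal]; norm_num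
    rw [h2]
    linarith

lemma cumulant_zero {d : ℕ} (γ : RSpace d) (Sig : Matrix (Fin d) (Fin d) ℝ)
    (ν : Measure (RSpace d)) : cumulant γ Sig ν 0 = 0 := by
  simp [cumulant]

/-! ### Matrices acting on vectors, and the squared Frobenius norm -/

lemma inner_matVec {n d : ℕ} (A : Matrix (Fin n) (Fin d) ℝ) (u : RSpace n) (x : RSpace d) :
    (inner ℝ u (matVec A x) : ℝ) = inner ℝ (matVec A.transpose u) x := by
  simp only [matVec, EuclideanSpace.inner_eq_star_dotProduct, star_trivial,
    Matrix.mulVec_transpose]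
  rw [dotProduct_comm, Matrix.dotProduct_mulVec, dotProduct_comm]

lemma matVec_zero_left {n d : ℕ} (u : RSpace d) : matVec (0 : Matrix (Fin n) (Fin d) ℝ) u = 0 := by
  ext i; simp [matVec]

lemma matVec_sum_left {n d : ℕ} {ι : Type*} (s : Finset ι) (A : ι → Matrix (Fin n) (Fin d) ℝ)
    (u : RSpace d) : matVec (∑ j ∈ s, A j) u = ∑ j ∈ s, matVec (A j) u := by
  ext i; simp [matVec, Matrix.sum_mulVec]

lemma measurable_matVec {n d : ℕ} (A : Matrix (Fin n) (Fin d) ℝ) : Measurable (matVec A) := by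
  unfold matVec
  refine (WithLp.measurable_toLp 2 _).comp ?_
  refine measurable_pi_lambda _ fun i => ?_
  simp only [Matrix.mulVec, dotProduct]
  fun_prop

lemma matVec_indicator {T : Type*} {n d : ℕ} (A : Set T) (φ : T → Matrix (Fin n) (Fin d) ℝ)
    (u : RSpace n) (p : T) :
    A.indicator (fun p => matVec (φ p).transpose u) p
      = matVec (A.indicator φ p).transpose u := by
  by_cases h : p ∈ A
  · simp [h]
  · simp [h, matVec_zero_left]

lemma matVec_sub_left {n d : ℕ} (A B : Matrix (Fin n) (Fin d) ℝ) (u : RSpace d) :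
    matVec (A - B) u = matVec A u - matVec B u := by
  ext i; simp [matVec, Matrix.sub_mulVec]

lemma matVec_neg_right {n d : ℕ} (A : Matrix (Fin n) (Fin d) ℝ) (u : RSpace d) :
    matVec A (-u) = - matVec A u := by
  ext i; simp [matVec, Matrix.mulVec_neg]

lemma continuous_matVec_transpose {n d : ℕ} (u : RSpace n) :
    Continuous fun A : Matrix (Fin n) (Fin d) ℝ => matVec A.transpose u := by
  unfold matVec
  refine (PiLp.continuous_toLp 2 _).comp ?_
  fun_prop

/-- The squared Frobenius norm, written as a sum of squares; see `frobNorm_sq`. -/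
def frobSq {n d : ℕ} (A : Matrix (Fin n) (Fin d) ℝ) : ℝ :=
  ∑ i, ∑ j, A i j ^ 2

lemma frobSq_nonneg {n d : ℕ} (A : Matrix (Fin n) (Fin d) ℝ) : 0 ≤ frobSq A :=
  Finset.sum_nonneg fun _ _ => Finset.sum_nonneg fun _ _ => sq_nonneg _

lemma frobNorm_sq {n d : ℕ} (A : Matrix (Fin n) (Fin d) ℝ) : frobNorm A ^ 2 = frobSq A := by
  have h : (A * A.transpose).trace = frobSq A := by
    simp [Matrix.trace, Matrix.mul_apply, frobSq, sq]
  rw [frobNorm, h, Real.sq_sqrt (frobSq_nonneg A)]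

lemma frobSq_neg {n d : ℕ} (A : Matrix (Fin n) (Fin d) ℝ) : frobSq (-A) = frobSq A := by
  simp [frobSq]

lemma frobSq_zero {n d : ℕ} : frobSq (0 : Matrix (Fin n) (Fin d) ℝ) = 0 := by
  simp [frobSq]

lemma frobSq_add_le {n d : ℕ} (A B : Matrix (Fin n) (Fin d) ℝ) :
    frobSq (A + B) ≤ 2 * frobSq A + 2 * frobSq B := by
  simp only [frobSq, Finset.mul_sum, ← Finset.sum_add_distrib]
  refine Finset.sum_le_sum fun i _ => Finset.sum_le_sum fun j _ => ?_
  rw [Matrix.add_apply]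
  nlinarith [sq_nonneg (A i j - B i j)]

lemma frobSq_sub_le {n d : ℕ} (A B : Matrix (Fin n) (Fin d) ℝ) :
    frobSq (A - B) ≤ 2 * frobSq A + 2 * frobSq B := by
  rw [sub_eq_add_neg, ← frobSq_neg B]
  exact frobSq_add_le A (-B)

lemma continuous_frobSq {n d : ℕ} :
    Continuous (frobSq : Matrix (Fin n) (Fin d) ℝ → ℝ) := by
  unfold frobSq; fun_prop

lemma sq_norm_matVec_transpose_single_le {n d : ℕ} (A : Matrix (Fin n) (Fin d) ℝ) (s : ℝ)
    (i : Fin n) : ‖matVec A.transpose (EuclideanSpace.single i s)‖ ^ 2 ≤ frobSq A * s ^ 2 := by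
  rw [EuclideanSpace.norm_sq_eq]
  have : ∀ j, (matVec A.transpose (EuclideanSpace.single i s)) j = A i j * s := by
    intro j
    simp [matVec, mul_comm]
  simp only [this, Real.norm_eq_abs, sq_abs, mul_pow]
  rw [← Finset.sum_mul]
  gcongr
  exact Finset.single_le_sum (f := fun i => ∑ j, A i j ^ 2)
    (fun i _ => Finset.sum_nonneg fun j _ => sq_nonneg _) (Finset.mem_univ i)

/-! ### Joint characteristic functions of a Lévy basis -/

lemma isBddBorel_empty {T : Type*} [Bornology T] [MeasurableSpace T] :
    IsBddBorel (∅ : Set T) :=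
  ⟨Bornology.isBounded_empty, MeasurableSet.empty⟩

lemma IsBddBorel.inter_left {T : Type*} [Bornology T] [MeasurableSpace T] {A B : Set T}
    (hB : IsBddBorel B) (hA : MeasurableSet A) : IsBddBorel (A ∩ B) :=
  ⟨hB.1.subset Set.inter_subset_right, hA.inter hB.2⟩

lemma isBddBorel_iUnion {ι T : Type*} [Finite ι] [Bornology T] [MeasurableSpace T] {B : ι → Set T}
    (hB : ∀ i, IsBddBorel (B i)) : IsBddBorel (⋃ i, B i) :=
  ⟨Bornology.isBounded_iUnion.2 fun i => (hB i).1, MeasurableSet.iUnion fun i => (hB i).2⟩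

/-- A bounded set has finite measure under `π × λ`: the first factor is finite, and the projection
to the second one is bounded. -/
lemma measure_lt_top_of_isBounded {S : Type*} [MetricSpace S] [MeasurableSpace S] {m : ℕ}
    (π : Measure S) [IsProbabilityMeasure π] {B : Set (S × RSpace m)}
    (hB : Bornology.IsBounded B) : π.prod (volume : Measure (RSpace m)) B < ∞ := by
  have h2 : Bornology.IsBounded (Prod.snd '' B) := hB.image_snd
  refine lt_of_le_of_lt (measure_mono (t := Set.univ ×ˢ (Prod.snd '' B)) fun p hp =>
    ⟨trivial, p, hp, rfl⟩) ?_
  rw [Measure.prod_prod]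
  simpa using h2.measure_lt_top

lemma sum_inner_integral_eq {Ω S : Type*} [MetricSpace S] [MeasurableSpace S] {m n d : ℕ}
    {L : Set (S × RSpace m) → Ω → RSpace d} {ι : Type*} [Fintype ι]
    (φ : ι → SimpleKernel (S × RSpace m) n d) (A : ι → Set (S × RSpace m)) (u : ι → RSpace n)
    (ω : Ω) :
    ∑ a, (inner ℝ (u a) ((φ a).integral L (A a) ω) : ℝ)
      = ∑ j : Σ a, Fin (φ a).size, inner ℝ (matVec ((φ j.1).coeff j.2).transpose (u j.1))
          (L (A j.1 ∩ (φ j.1).sets j.2) ω) := by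
  rw [Fintype.sum_sigma]
  refine Finset.sum_congr rfl fun a _ => ?_
  rw [SimpleKernel.integral, inner_sum]
  exact Finset.sum_congr rfl fun j _ => inner_matVec _ _ _

lemma sum_indicator_matVec_eq {S : Type*} [MetricSpace S] [MeasurableSpace S] {m n d : ℕ}
    {ι : Type*} [Fintype ι]
    (φ : ι → SimpleKernel (S × RSpace m) n d) (A : ι → Set (S × RSpace m)) (u : ι → RSpace n)
    (p : S × RSpace m) :
    ∑ a, (A a).indicator (fun p => matVec ((φ a).toFun p).transpose (u a)) p
      = ∑ j : Σ a, Fin (φ a).size, (A j.1 ∩ (φ j.1).sets j.2).indicator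
          (fun _ => matVec ((φ j.1).coeff j.2).transpose (u j.1)) p := by
  classical
  rw [Fintype.sum_sigma]
  refine Finset.sum_congr rfl fun a _ => ?_
  rw [Set.indicator_apply]
  split_ifs with h
  · rw [SimpleKernel.toFun, Matrix.transpose_sum, matVec_sum_left]
    refine Finset.sum_congr rfl fun j _ => ?_
    by_cases hj : p ∈ (φ a).sets j
    · simp [h, hj]
    · simp [hj, matVec_zero_left]
  · exact (Finset.sum_eq_zero fun j _ => Set.indicator_of_notMem (fun hp => h hp.1) _).symm

section LevyBasis

variable {Ω S : Type*} [MeasurableSpace Ω] {P : Measure Ω} [MetricSpace S] [MeasurableSpace S]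
  {m d n : ℕ} {L : Set (S × RSpace m) → Ω → RSpace d}

lemma IsLevyBasis.ae_empty_eq_zero (hL : IsLevyBasis P L) : ∀ᵐ ω ∂P, L ∅ ω = 0 := by
  have h := hL.sigmaAdditive (fun _ => ∅) (fun _ => isBddBorel_empty)
    (fun _ _ _ => by simp [Function.onFun]) (by simpa using isBddBorel_empty)
  filter_upwards [h] with ω hω
  have h1 := (tendsto_add_atTop_iff_nat 1).2 hω
  have h2 := h1.sub hω
  simp only [Finset.sum_range_succ, add_sub_cancel_left, sub_self] at h2
  exact tendsto_nhds_unique tendsto_const_nhds h2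

lemma IsLevyBasis.ae_iUnion_fin_eq_sum (hL : IsLevyBasis P L) {k : ℕ}
    {B : Fin k → Set (S × RSpace m)} (hB : ∀ i, IsBddBorel (B i))
    (hd : Pairwise (Function.onFun Disjoint B)) :
    ∀ᵐ ω ∂P, L (⋃ i, B i) ω = ∑ i, L (B i) ω := by
  let C : ℕ → Set (S × RSpace m) := fun i => if h : i < k then B ⟨i, h⟩ else ∅
  have hC : ∀ i, IsBddBorel (C i) := fun i => by
    by_cases h : i < k
    · simpa [C, h] using hB _
    · simpa [C, h] using isBddBorel_empty
  have hCd : Pairwise (Function.onFun Disjoint C) := fun i j hij => by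
    by_cases hi : i < k <;> by_cases hj : j < k <;> simp only [Function.onFun, C, hi, hj, dif_pos,
      dif_neg, not_false_eq_true, Set.empty_disjoint, Set.disjoint_empty]
    exact hd (by simpa using hij)
  have hU : ⋃ i, C i = ⋃ i, B i := by
    ext p
    simp only [Set.mem_iUnion]
    constructor
    · rintro ⟨i, hi⟩
      by_cases h : i < k
      · exact ⟨⟨i, h⟩, by simpa [C, h] using hi⟩
      · simp [C, h] at hi
    · rintro ⟨i, hi⟩
      exact ⟨i, by simpa [C, i.2] using hi⟩
  filter_upwards [hL.sigmaAdditive C hC hCd (by rw [hU]; exact isBddBorel_iUnion hB),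
    hL.ae_empty_eq_zero] with ω hω h0
  rw [hU] at hω
  refine tendsto_nhds_unique hω (tendsto_atTop_of_eventually_const (i₀ := k) fun N hN => ?_)
  obtain ⟨r, rfl⟩ := Nat.exists_eq_add_of_le hN
  rw [Finset.sum_range_add, Finset.sum_range]
  have h1 : ∀ i ∈ Finset.range r, L (C (k + i)) ω = 0 := fun i _ => by simp [C, h0]
  rw [Finset.sum_eq_zero h1, add_zero]
  exact Finset.sum_congr rfl fun i _ => by simp [C]

lemma IsLevyBasis.ae_iUnion_eq_sum (hL : IsLevyBasis P L) {ι : Type*} [Fintype ι]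
    {B : ι → Set (S × RSpace m)} (hB : ∀ i, IsBddBorel (B i))
    (hd : Pairwise (Function.onFun Disjoint B)) :
    ∀ᵐ ω ∂P, L (⋃ i, B i) ω = ∑ i, L (B i) ω := by
  let e := Fintype.equivFin ι
  filter_upwards [hL.ae_iUnion_fin_eq_sum (B := fun i => B (e.symm i)) (fun i => hB _)
    (fun i j hij => hd (e.symm.injective.ne hij))] with ω hω
  rw [e.symm.surjective.iUnion_comp (g := B)] at hω
  rw [hω]
  exact e.symm.sum_comp fun i => L (B i) ω

lemma IsLevyBasis.iIndepFun_of_disjoint (hL : IsLevyBasis P L) {ι : Type*} [Fintype ι]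
    {B : ι → Set (S × RSpace m)} (hB : ∀ i, IsBddBorel (B i))
    (hd : Pairwise (Function.onFun Disjoint B)) : iIndepFun (fun i => L (B i)) P := by
  let e := Fintype.equivFin ι
  have h := hL.independent _ (fun i => B (e.symm i)) (fun i => hB _)
    (fun i j hij => hd (e.symm.injective.ne hij))
  have h2 := h.precomp e.injective
  simpa [Function.comp_def] using h2

/-- The atom of the family `B` belonging to the index set `J`: the points of the union that lie in
exactly the sets `B j`, `j ∈ J`. -/
def atom {ι T : Type*} (B : ι → Set T) (J : Finset ι) : Set T :=
  (⋃ j, B j) ∩ {p | ∀ j, p ∈ B j ↔ j ∈ J}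

lemma isBddBorel_atom {ι T : Type*} [Finite ι] [Bornology T] [MeasurableSpace T] {B : ι → Set T}
    (hB : ∀ i, IsBddBorel (B i)) (J : Finset ι) : IsBddBorel (atom B J) := by
  refine ⟨(isBddBorel_iUnion hB).1.subset Set.inter_subset_left,
    (isBddBorel_iUnion hB).2.inter ?_⟩
  rw [Set.ofPred_forall]
  exact MeasurableSet.iInter fun j => MeasurableSet.iff (hB j).2 (MeasurableSet.const _)

lemma pairwise_disjoint_atom {ι T : Type*} (B : ι → Set T) :
    Pairwise (Function.onFun Disjoint (atom B)) := by
  refine fun J J' hJ => Set.disjoint_left.2 fun p hp hp' => hJ ?_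
  ext j
  rw [← hp.2 j, hp'.2 j]

open Classical in
lemma eq_iUnion_atom {ι T : Type*} [Fintype ι] (B : ι → Set T) (j : ι) :
    B j = ⋃ J : {J : Finset ι // j ∈ J}, atom B J := by
  ext p
  simp only [Set.mem_iUnion, Subtype.exists]
  constructor
  · intro hp
    refine ⟨Finset.univ.filter fun i => p ∈ B i, by simpa using hp, Set.mem_iUnion.2 ⟨j, hp⟩, ?_⟩
    intro i; simp
  · rintro ⟨J, hJ, hp⟩
    exact (hp.2 j).2 hJ

open Classical in
/-- A function of the position relative to the family `B`, vanishing off the union, is a step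
function on the atoms. -/
lemma apply_sum_indicator_eq_sum_atom {ι T E : Type*} [Fintype ι] [AddCommMonoid E]
    (B : ι → Set T) (w : ι → E) (Φ : E → ℂ) (h0 : Φ 0 = 0) (p : T) :
    Φ (∑ j, (B j).indicator (fun _ => w j) p)
      = ∑ J : Finset ι, (atom B J).indicator (fun _ => Φ (∑ j ∈ J, w j)) p := by
  let J₀ := Finset.univ.filter fun i => p ∈ B i
  have h1 : ∑ j, (B j).indicator (fun _ => w j) p = ∑ j ∈ J₀, w j := by
    rw [Finset.sum_filter]
    exact Finset.sum_congr rfl fun j _ => by simp [Set.indicator_apply]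
  have h2 : ∀ J, J ≠ J₀ → (atom B J).indicator (fun _ => Φ (∑ j ∈ J, w j)) p = 0 := by
    intro J hJ
    refine Set.indicator_of_notMem (fun hp => hJ ?_) _
    ext j
    simp [J₀, ← hp.2 j]
  rw [h1, Finset.sum_eq_single J₀ (fun J _ hJ => h2 J hJ) (by simp)]
  by_cases hp : p ∈ ⋃ j, B j
  · rw [Set.indicator_of_mem]
    exact ⟨hp, fun j => by simp [J₀]⟩
  · rw [Set.indicator_of_notMem fun h => hp h.1]
    have : J₀ = ∅ := by
      ext j
      simp only [Set.mem_iUnion, not_exists] at hp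
      simp [J₀, hp j]
    simp [this, h0]

variable {γ : RSpace d} {Sig : Matrix (Fin d) (Fin d) ℝ} {ν : Measure (RSpace d)} {π : Measure S}

lemma integrable_cumulant_sum_indicator [IsProbabilityMeasure π] {ι : Type*} [Fintype ι]
    {B : ι → Set (S × RSpace m)} (hB : ∀ i, IsBddBorel (B i)) (w : ι → RSpace d) :
    Integrable (fun p => cumulant γ Sig ν (∑ j, (B j).indicator (fun _ => w j) p))
      (π.prod volume) := by
  simp_rw [apply_sum_indicator_eq_sum_atom B w _ (cumulant_zero γ Sig ν)]
  refine integrable_finsetSum _ fun J _ => ?_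
  rw [integrable_indicator_iff (isBddBorel_atom hB J).2]
  exact integrableOn_const (measure_lt_top_of_isBounded π (isBddBorel_atom hB J).1).ne

/-- The joint characteristic function of the values of a Lévy basis on finitely many, possibly
overlapping, sets. The values on the atoms of the family are independent. -/
lemma integral_exp_sum_inner_eq [IsProbabilityMeasure P] (hL : IsLevyBasis P L)
    (hquad : HasCharacteristicQuadruplet P L γ Sig ν π) {ι : Type*} [Fintype ι]
    {B : ι → Set (S × RSpace m)} (hB : ∀ i, IsBddBorel (B i)) (w : ι → RSpace d) :
    ∫ ω, Complex.exp (Complex.I * ((∑ j, inner ℝ (w j) (L (B j) ω) : ℝ) : ℂ)) ∂P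
      = Complex.exp (∫ p, cumulant γ Sig ν (∑ j, (B j).indicator (fun _ => w j) p)
          ∂(π.prod volume)) := by
  classical
  have := hquad.isProbabilityMeasure
  have hA := isBddBorel_atom hB
  have hsum : ∀ᵐ ω ∂P, ∑ j, inner ℝ (w j) (L (B j) ω)
      = ∑ J : Finset ι, inner ℝ (∑ j ∈ J, w j) (L (atom B J) ω) := by
    have h : ∀ j, ∀ᵐ ω ∂P, L (B j) ω = ∑ J : {J : Finset ι // j ∈ J}, L (atom B J) ω := by
      intro j
      have := hL.ae_iUnion_eq_sum (B := fun J : {J : Finset ι // j ∈ J} => atom B J.1)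
        (fun J => hA _) (fun J J' hJ => pairwise_disjoint_atom B fun h => hJ (Subtype.ext h))
      rwa [← eq_iUnion_atom B j] at this
    filter_upwards [ae_all_iff.2 h] with ω hω
    have h1 : ∀ j, inner ℝ (w j) (L (B j) ω)
        = ∑ J : Finset ι, if j ∈ J then inner ℝ (w j) (L (atom B J) ω) else 0 := by
      intro j
      rw [hω j, inner_sum, ← Finset.sum_filter]
      exact (Finset.sum_subtype _ (by simp) fun J => inner ℝ (w j) (L (atom B J) ω)).symm
    simp_rw [h1]
    rw [Finset.sum_comm]
    refine Finset.sum_congr rfl fun J _ => ?_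
    rw [sum_inner, ← Finset.sum_filter]
    simp
  have hind := hL.iIndepFun_of_disjoint hA (pairwise_disjoint_atom B)
  calc _ = ∫ ω, ∏ J : Finset ι, Complex.exp (Complex.I *
        ((inner ℝ (∑ j ∈ J, w j) (L (atom B J) ω) : ℝ) : ℂ)) ∂P := by
        refine integral_congr_ae ?_
        filter_upwards [hsum] with ω hω
        rw [hω, ← Complex.exp_sum, Complex.ofReal_sum, Finset.mul_sum]
    _ = ∏ J : Finset ι, ∫ ω, Complex.exp (Complex.I *
        ((inner ℝ (∑ j ∈ J, w j) (L (atom B J) ω) : ℝ) : ℂ)) ∂P :=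
        hind.integral_fun_prod_comp (fun J => hL.aemeasurable _ (hA J))
          (f := fun J x => Complex.exp (Complex.I * ((inner ℝ (∑ j ∈ J, w j) x : ℝ) : ℂ)))
          (fun J => by fun_prop)
    _ = _ := by
        simp_rw [hquad.charFun_eq _ (hA _)]
        rw [← Complex.exp_sum]
        simp_rw [apply_sum_indicator_eq_sum_atom B w _ (cumulant_zero γ Sig ν)]
        rw [integral_finsetSum]
        · congr 1
          refine Finset.sum_congr rfl fun J _ => ?_
          rw [integral_indicator (hA J).2, setIntegral_const, Complex.real_smul, mul_comm]
        · intro J _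
          rw [integrable_indicator_iff (hA J).2]
          exact integrableOn_const (measure_lt_top_of_isBounded π (hA J).1).ne

/-! ### Integrals of simple kernels -/

lemma aemeasurable_integral (hL : IsLevyBasis P L) (φ : SimpleKernel (S × RSpace m) n d)
    {A : Set (S × RSpace m)} (hA : MeasurableSet A) : AEMeasurable (φ.integral L A) P := by
  unfold SimpleKernel.integral
  exact Finset.aemeasurable_fun_sum _ fun j _ => (measurable_matVec _).comp_aemeasurable
    (hL.aemeasurable _ ((φ.bddBorel j).inter_left hA))

/-- The joint characteristic function of integrals of simple kernels. -/
lemma integral_exp_sum_inner_integral_eq [IsProbabilityMeasure P] (hL : IsLevyBasis P L)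
    (hquad : HasCharacteristicQuadruplet P L γ Sig ν π) {ι : Type*} [Fintype ι]
    (φ : ι → SimpleKernel (S × RSpace m) n d) {A : ι → Set (S × RSpace m)}
    (hA : ∀ a, MeasurableSet (A a)) (u : ι → RSpace n) :
    ∫ ω, Complex.exp (Complex.I * ((∑ a, inner ℝ (u a) ((φ a).integral L (A a) ω) : ℝ) : ℂ)) ∂P
      = Complex.exp (∫ p, cumulant γ Sig ν
          (∑ a, (A a).indicator (fun p => matVec ((φ a).toFun p).transpose (u a)) p)
          ∂(π.prod volume)) := by
  simp_rw [sum_inner_integral_eq φ A u, sum_indicator_matVec_eq φ A u]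
  exact integral_exp_sum_inner_eq hL hquad
    (B := fun j : Σ a, Fin (φ a).size => A j.1 ∩ (φ j.1).sets j.2)
    (fun j => ((φ j.1).bddBorel j.2).inter_left (hA j.1))
    (fun j => matVec ((φ j.1).coeff j.2).transpose (u j.1))

lemma integrable_cumulant_sum_matVec [IsProbabilityMeasure π] {ι : Type*} [Fintype ι]
    (φ : ι → SimpleKernel (S × RSpace m) n d) {A : ι → Set (S × RSpace m)}
    (hA : ∀ a, MeasurableSet (A a)) (u : ι → RSpace n) :
    Integrable (fun p => cumulant γ Sig ν
      (∑ a, (A a).indicator (fun p => matVec ((φ a).toFun p).transpose (u a)) p))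
      (π.prod volume) := by
  simp_rw [sum_indicator_matVec_eq φ A u]
  exact integrable_cumulant_sum_indicator
    (B := fun j : Σ a, Fin (φ a).size => A j.1 ∩ (φ j.1).sets j.2)
    (fun j => ((φ j.1).bddBorel j.2).inter_left (hA j.1))
    (fun j => matVec ((φ j.1).coeff j.2).transpose (u j.1))

end LevyBasis

/-! ### Independence and second moments -/

/-- The exponential is `1`-Lipschitz on the left half-plane. -/
lemma norm_exp_sub_exp_le {z w : ℂ} (hz : z.re ≤ 0) (hw : w.re ≤ 0) :
    ‖Complex.exp z - Complex.exp w‖ ≤ ‖z - w‖ := by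
  have h := (convex_halfSpace_re_le (0 : ℝ)).norm_image_sub_le_of_norm_hasDerivWithin_le
    (f := Complex.exp) (f' := Complex.exp) (C := 1)
    (fun x _ => (Complex.hasDerivAt_exp x).hasDerivWithinAt)
    (fun x hx => by rw [Complex.norm_exp]; exact Real.exp_le_one_iff.2 hx) hw hz
  simpa using h

/-- Two finite random families are independent if their joint characteristic function is a
product. -/
lemma indepFun_of_charFun_mul {Ω : Type*} [MeasurableSpace Ω] {P : Measure Ω}
    [IsProbabilityMeasure P] {ι κ : Type*} [Fintype ι] [Fintype κ] {n : ℕ}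
    {X : Ω → ι → RSpace n} {Y : Ω → κ → RSpace n} (hX : AEMeasurable X P) (hY : AEMeasurable Y P)
    (h : ∀ (s : ι → RSpace n) (t : κ → RSpace n),
      ∫ ω, Complex.exp (Complex.I * ((∑ a, inner ℝ (s a) (X ω a)
        + ∑ b, inner ℝ (t b) (Y ω b) : ℝ) : ℂ)) ∂P
      = (∫ ω, Complex.exp (Complex.I * ((∑ a, inner ℝ (s a) (X ω a) : ℝ) : ℂ)) ∂P)
        * ∫ ω, Complex.exp (Complex.I * ((∑ b, inner ℝ (t b) (Y ω b) : ℝ) : ℂ)) ∂P) :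
    IndepFun X Y P := by
  have hX' : AEMeasurable (fun ω => WithLp.toLp 2 (X ω)) P :=
    (WithLp.measurable_toLp 2 _).comp_aemeasurable hX
  have hY' : AEMeasurable (fun ω => WithLp.toLp 2 (Y ω)) P :=
    (WithLp.measurable_toLp 2 _).comp_aemeasurable hY
  have key : IndepFun (fun ω => WithLp.toLp 2 (X ω)) (fun ω => WithLp.toLp 2 (Y ω)) P := by
    rw [indepFun_iff_charFun_prod hX' hY']
    intro t
    simp only [charFun_apply]
    rw [integral_map (by fun_prop) (by fun_prop), integral_map hX' (by fun_prop),
      integral_map hY' (by fun_prop)]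
    have hι : ∀ x y : PiLp 2 (fun _ : ι => RSpace n),
        (inner ℝ x y : ℝ) = ∑ a, inner ℝ (y a) (x a) := fun x y => by
      rw [PiLp.inner_apply]
      exact Finset.sum_congr rfl fun _ _ => real_inner_comm _ _
    have hκ : ∀ x y : PiLp 2 (fun _ : κ => RSpace n),
        (inner ℝ x y : ℝ) = ∑ b, inner ℝ (y b) (x b) := fun x y => by
      rw [PiLp.inner_apply]
      exact Finset.sum_congr rfl fun _ _ => real_inner_comm _ _
    have := h (fun a => t.fst a) (fun b => t.snd b)
    simp only [mul_comm Complex.I] at this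
    simp only [WithLp.prod_inner_apply, hι, hκ]
    exact this
  exact key.comp (WithLp.measurable_ofLp 2 _) (WithLp.measurable_ofLp 2 _)

/-- A quadratic bound on the log-characteristic function bounds the second moment, by Fatou's lemma
for the functions `s⁻² (1 - cos (s Z))` as `s → 0`. -/
lemma lintegral_sq_le_of_charFun {Ω : Type*} [MeasurableSpace Ω] {P : Measure Ω}
    [IsProbabilityMeasure P] {Z : Ω → ℝ} (hZ : AEMeasurable Z P) {w : ℝ → ℂ} {K : ℝ}
    (hw : ∀ s : ℝ, ∫ ω, Complex.exp (Complex.I * ((s * Z ω : ℝ) : ℂ)) ∂P = Complex.exp (w s))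
    (hre : ∀ s, (w s).re ≤ 0) (hK : ∀ s, ‖w s‖ ≤ K * s ^ 2) :
    ∫⁻ ω, ENNReal.ofReal (Z ω ^ 2) ∂P ≤ ENNReal.ofReal (Real.pi ^ 2 / 2 * K) := by
  have hpi := Real.pi_pos
  let F : ℕ → Ω → ℝ := fun k ω =>
    Real.pi ^ 2 / 2 * ((k : ℝ) + 1) ^ 2 * (1 - Real.cos ((1 / ((k : ℝ) + 1)) * Z ω))
  have hFnn : ∀ k ω, 0 ≤ F k ω := fun k ω =>
    mul_nonneg (by positivity) (by linarith [Real.cos_le_one ((1 / ((k : ℝ) + 1)) * Z ω)])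
  have hcos : ∀ s : ℝ, Integrable (fun ω => Real.cos (s * Z ω)) P := fun s =>
    Integrable.of_bound (by fun_prop) 1 (ae_of_all _ fun ω => by
      simpa using Real.abs_cos_le_one _)
  have hFi : ∀ k, Integrable (F k) P := fun k => ((integrable_const 1).sub (hcos _)).const_mul _
  have hcosint : ∀ s : ℝ, ∫ ω, Real.cos (s * Z ω) ∂P = (Complex.exp (w s)).re := by
    intro s
    rw [← hw s, ← RCLike.re_eq_complex_re, ← integral_re]
    · congr 1; ext ω
      rw [mul_comm Complex.I, RCLike.re_eq_complex_re, Complex.exp_ofReal_mul_I_re]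
    · refine Integrable.of_bound (by fun_prop) 1 (ae_of_all _ fun ω => ?_)
      rw [mul_comm, Complex.norm_exp_ofReal_mul_I]
  have hFle : ∀ k, ∫⁻ ω, ENNReal.ofReal (F k ω) ∂P ≤ ENNReal.ofReal (Real.pi ^ 2 / 2 * K) := by
    intro k
    rw [← ofReal_integral_eq_lintegral_ofReal (hFi k) (ae_of_all _ (hFnn k))]
    refine ENNReal.ofReal_le_ofReal ?_
    simp only [F]
    rw [integral_const_mul, integral_sub (integrable_const _) (hcos _), hcosint]
    have h1 : 1 - (Complex.exp (w (1 / ((k : ℝ) + 1)))).re ≤ K * (1 / ((k : ℝ) + 1)) ^ 2 := by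
      refine le_trans ?_ (hK _)
      have h2 := norm_exp_sub_exp_le (z := 0) (w := w (1 / ((k : ℝ) + 1))) le_rfl (hre _)
      rw [zero_sub, norm_neg] at h2
      refine le_trans ?_ h2
      have := Complex.re_le_norm (Complex.exp 0 - Complex.exp (w (1 / ((k : ℝ) + 1))))
      simpa using this
    have h3 : (0 : ℝ) < (k : ℝ) + 1 := by positivity
    calc _ ≤ Real.pi ^ 2 / 2 * ((k : ℝ) + 1) ^ 2 * (K * (1 / ((k : ℝ) + 1)) ^ 2) := by
          gcongr
          simpa using h1
      _ = _ := by field_simp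
  calc ∫⁻ ω, ENNReal.ofReal (Z ω ^ 2) ∂P
      ≤ ∫⁻ ω, liminf (fun k => ENNReal.ofReal (F k ω)) atTop ∂P := by
        refine lintegral_mono fun ω => ?_
        refine le_liminf_of_le (by isBoundedDefault) ?_
        have ht : Tendsto (fun k : ℕ => (1 / ((k : ℝ) + 1)) * Z ω) atTop (𝓝 (0 * Z ω)) :=
          tendsto_one_div_add_atTop_nhds_zero_nat.mul_const _
        rw [zero_mul] at ht
        have := ht.abs.eventually_le_const (u := Real.pi) (by simpa using hpi)
        filter_upwards [this] with k hk
        refine ENNReal.ofReal_le_ofReal ?_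
        have h1 := Real.cos_le_one_sub_mul_cos_sq hk
        have h3 : (0 : ℝ) < (k : ℝ) + 1 := by positivity
        calc Z ω ^ 2 = Real.pi ^ 2 / 2 * ((k : ℝ) + 1) ^ 2 *
              (2 / Real.pi ^ 2 * ((1 / ((k : ℝ) + 1)) * Z ω) ^ 2) := by field_simp
          _ ≤ _ := by
            simp only [F]
            gcongr
            linarith
    _ ≤ liminf (fun k => ∫⁻ ω, ENNReal.ofReal (F k ω) ∂P) atTop :=
        lintegral_liminf_le' fun k => (hFi k).aemeasurable.ennreal_ofReal
    _ ≤ _ := by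
        refine liminf_le_of_frequently_le' (Frequently.of_forall hFle)

section LevyBasis

variable {Ω S : Type*} [MeasurableSpace Ω] {P : Measure Ω} [MetricSpace S] [MeasurableSpace S]
  {m d n : ℕ} {L : Set (S × RSpace m) → Ω → RSpace d}
  {γ : RSpace d} {Sig : Matrix (Fin d) (Fin d) ℝ} {ν : Measure (RSpace d)} {π : Measure S}

/-- Integrals over disjoint sets are independent: the cumulant of a sum of two terms of which one
vanishes is additive. -/
lemma indepFun_integral_of_disjoint [IsProbabilityMeasure P] (hL : IsLevyBasis P L)
    (hquad : HasCharacteristicQuadruplet P L γ Sig ν π) {ι κ : Type*} [Fintype ι] [Fintype κ]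
    (φ : ι → SimpleKernel (S × RSpace m) n d) (ψ : κ → SimpleKernel (S × RSpace m) n d)
    {A : ι → Set (S × RSpace m)} {B : κ → Set (S × RSpace m)}
    (hA : ∀ a, MeasurableSet (A a)) (hB : ∀ b, MeasurableSet (B b))
    (hAB : ∀ a b, Disjoint (A a) (B b)) :
    IndepFun (fun ω a => (φ a).integral L (A a) ω) (fun ω b => (ψ b).integral L (B b) ω) P := by
  have := hquad.isProbabilityMeasure
  refine indepFun_of_charFun_mul
    (aemeasurable_pi_lambda _ fun a => aemeasurable_integral hL _ (hA a))
    (aemeasurable_pi_lambda _ fun b => aemeasurable_integral hL _ (hB b)) fun s t => ?_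
  rw [integral_exp_sum_inner_integral_eq hL hquad φ hA s,
    integral_exp_sum_inner_integral_eq hL hquad ψ hB t, ← Complex.exp_add,
    ← integral_add (integrable_cumulant_sum_matVec φ hA s) (integrable_cumulant_sum_matVec ψ hB t)]
  have h := integral_exp_sum_inner_integral_eq hL hquad (Sum.elim φ ψ) (A := Sum.elim A B)
    (by rintro (a | b) <;> simp [hA, hB]) (Sum.elim s t)
  simp only [Fintype.sum_sum_type, Sum.elim_inl, Sum.elim_inr] at h
  rw [h]
  congr 1
  refine integral_congr_ae (ae_of_all _ fun p => ?_)
  simp only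
  by_cases hp : ∃ a, p ∈ A a
  · obtain ⟨a, ha⟩ := hp
    have h0 : ∑ b, (B b).indicator (fun p => matVec ((ψ b).toFun p).transpose (t b)) p = 0 :=
      Finset.sum_eq_zero fun b _ =>
        Set.indicator_of_notMem (Set.disjoint_left.1 (hAB a b) ha) _
    rw [h0, cumulant_zero, add_zero, add_zero]
  · have h0 : ∑ a, (A a).indicator (fun p => matVec ((φ a).toFun p).transpose (s a)) p = 0 :=
      Finset.sum_eq_zero fun a _ => Set.indicator_of_notMem (fun ha => hp ⟨a, ha⟩) _
    rw [h0, cumulant_zero, zero_add, zero_add]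

/-- The characteristic function of the difference of two integrals of simple kernels. -/
lemma integral_exp_inner_sub_eq [IsProbabilityMeasure P] (hL : IsLevyBasis P L)
    (hquad : HasCharacteristicQuadruplet P L γ Sig ν π)
    (φ ψ : SimpleKernel (S × RSpace m) n d) {A B : Set (S × RSpace m)}
    (hA : MeasurableSet A) (hB : MeasurableSet B) (u : RSpace n) :
    ∫ ω, Complex.exp (Complex.I *
        ((inner ℝ u (φ.integral L A ω - ψ.integral L B ω) : ℝ) : ℂ)) ∂P
      = Complex.exp (∫ p, cumulant γ Sig ν
          (matVec (A.indicator φ.toFun p - B.indicator ψ.toFun p).transpose u)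
          ∂(π.prod volume)) := by
  have h := integral_exp_sum_inner_integral_eq hL hquad ![φ, ψ] (A := ![A, B])
    (by intro a; fin_cases a <;> simp [hA, hB]) ![u, -u]
  simp only [Fin.sum_univ_two, Matrix.cons_val_zero, Matrix.cons_val_one, inner_neg_left,
    ← sub_eq_add_neg, ← inner_sub_right, matVec_indicator, matVec_neg_right] at h
  simpa only [Matrix.transpose_sub, matVec_sub_left] using h

lemma integrable_cumulant_matVec_sub [IsProbabilityMeasure π]
    (φ ψ : SimpleKernel (S × RSpace m) n d) {A B : Set (S × RSpace m)}
    (hA : MeasurableSet A) (hB : MeasurableSet B) (u : RSpace n) :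
    Integrable (fun p => cumulant γ Sig ν
      (matVec (A.indicator φ.toFun p - B.indicator ψ.toFun p).transpose u)) (π.prod volume) := by
  have h := integrable_cumulant_sum_matVec (γ := γ) (Sig := Sig) (ν := ν) (π := π)
    ![φ, ψ] (A := ![A, B]) (by intro a; fin_cases a <;> simp [hA, hB]) ![u, -u]
  simp only [Fin.sum_univ_two, Matrix.cons_val_zero, Matrix.cons_val_one,
    ← sub_eq_add_neg, matVec_indicator, matVec_neg_right] at h
  simpa only [Matrix.transpose_sub, matVec_sub_left] using h

/-- The `L²` estimate for integrals of simple kernels, a one-sided form of the Itô isometry. The two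
sets of integration may differ, so that it covers truncation as well as approximation. -/
lemma exists_lintegral_sq_norm_sub_le [IsProbabilityMeasure P] (hL : IsLevyBasis P L)
    (hquad : HasCharacteristicQuadruplet P L γ Sig ν π)
    (hmoment : ∫⁻ x in {x | 1 < ‖x‖}, ENNReal.ofReal (‖x‖ ^ 2) ∂ν < ∞)
    (hcentered : γ + ∫ x in {x | 1 < ‖x‖}, x ∂ν = 0) (n : ℕ) :
    ∃ K : ℝ, 0 < K ∧ ∀ (φ ψ : SimpleKernel (S × RSpace m) n d) (A B : Set (S × RSpace m)),
      MeasurableSet A → MeasurableSet B →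
      ∫⁻ ω, ‖φ.integral L A ω - ψ.integral L B ω‖ₑ ^ 2 ∂P ≤ ENNReal.ofReal K *
        ∫⁻ p, ENNReal.ofReal (frobSq (A.indicator φ.toFun p - B.indicator ψ.toFun p))
          ∂(π.prod volume) := by
  have := hquad.isProbabilityMeasure
  obtain ⟨K, hK0, hK⟩ := exists_norm_cumulant_le hquad.posSemidef hquad.isLevyMeasure hmoment
    hcentered
  refine ⟨n * (Real.pi ^ 2 / 2 * K) + 1, by positivity, fun φ ψ A B hA hB => ?_⟩
  set D := ∫⁻ p, ENNReal.ofReal (frobSq (A.indicator φ.toFun p - B.indicator ψ.toFun p))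
    ∂(π.prod volume) with hD
  rcases eq_or_ne D ∞ with hDtop | hDtop
  · rw [hDtop, ENNReal.mul_top (by rw [Ne, ENNReal.ofReal_eq_zero, not_le]; positivity)]
    exact le_top
  set Y : Ω → RSpace n := fun ω => φ.integral L A ω - ψ.integral L B ω with hYdef
  have hY : AEMeasurable Y P := (aemeasurable_integral hL φ hA).sub (aemeasurable_integral hL ψ hB)
  have hcoord : ∀ i : Fin n, ∫⁻ ω, ENNReal.ofReal (Y ω i ^ 2) ∂P
      ≤ ENNReal.ofReal (Real.pi ^ 2 / 2 * (K * D.toReal)) := by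
    intro i
    refine lintegral_sq_le_of_charFun (by fun_prop) (w := fun s => ∫ p, cumulant γ Sig ν
          (matVec (A.indicator φ.toFun p - B.indicator ψ.toFun p).transpose
            (EuclideanSpace.single i s)) ∂(π.prod volume)) (fun s => ?_) (fun s => ?_) fun s => ?_
    · rw [← integral_exp_inner_sub_eq hL hquad φ ψ hA hB]
      simp [EuclideanSpace.inner_single_left, Y]
    · rw [← RCLike.re_eq_complex_re, ← integral_re (integrable_cumulant_matVec_sub φ ψ hA hB _)]
      exact integral_nonpos fun p => (hK _).2
    · have h1 : ‖∫ p, cumulant γ Sig ν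
          (matVec (A.indicator φ.toFun p - B.indicator ψ.toFun p).transpose
            (EuclideanSpace.single i s)) ∂(π.prod volume)‖ₑ ≤ ENNReal.ofReal (K * s ^ 2) * D := by
        refine (enorm_integral_le_lintegral_enorm _).trans ?_
        rw [hD, ← lintegral_const_mul' _ _ ENNReal.ofReal_ne_top]
        refine lintegral_mono fun p => ?_
        simp only
        rw [← ofReal_norm, ← ENNReal.ofReal_mul (by positivity)]
        refine ENNReal.ofReal_le_ofReal ((hK _).1.trans ?_)
        rw [mul_assoc]
        gcongr
        rw [mul_comm]
        exact sq_norm_matVec_transpose_single_le _ _ _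
      have h2 := ENNReal.toReal_mono (ENNReal.mul_ne_top ENNReal.ofReal_ne_top hDtop) h1
      rw [toReal_enorm, ENNReal.toReal_mul, ENNReal.toReal_ofReal (by positivity)] at h2
      linarith
  have hnorm : ∀ ω, ‖Y ω‖ₑ ^ 2 = ∑ i, ENNReal.ofReal (Y ω i ^ 2) := by
    intro ω
    rw [← ofReal_norm, ← ENNReal.ofReal_pow (norm_nonneg _), EuclideanSpace.norm_sq_eq,
      ENNReal.ofReal_sum_of_nonneg fun _ _ => by positivity]
    simp
  calc ∫⁻ ω, ‖Y ω‖ₑ ^ 2 ∂P = ∑ i, ∫⁻ ω, ENNReal.ofReal (Y ω i ^ 2) ∂P := by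
        simp_rw [hnorm]
        exact lintegral_finsetSum' _ fun i _ => by fun_prop
    _ ≤ ∑ _i : Fin n, ENNReal.ofReal (Real.pi ^ 2 / 2 * (K * D.toReal)) :=
        Finset.sum_le_sum fun i _ => hcoord i
    _ = ENNReal.ofReal (n * (Real.pi ^ 2 / 2 * K)) * D := by
        rw [Finset.sum_const, Finset.card_univ, Fintype.card_fin, nsmul_eq_mul,
          ← mul_assoc, ENNReal.ofReal_mul (by positivity), ENNReal.ofReal_toReal hDtop,
          ← ENNReal.ofReal_natCast n, ← mul_assoc, ← ENNReal.ofReal_mul (by positivity)]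
    _ ≤ _ := by gcongr; linarith

end LevyBasis

/-! ### A gliding hump argument and uniqueness of the stochastic integral -/

/-- Auxiliary form of `tendsto_exp_integral_one` for measurable integrands. -/
lemma tendsto_exp_integral_one_of_measurable {T : Type*} [MeasurableSpace T] {μ : Measure T}
    [SigmaFinite μ] {h : ℕ → T → ℂ} (hmeas : ∀ k, Measurable (h k))
    (hint : ∀ k, Integrable (h k) μ) (hre : ∀ k, ∀ᵐ p ∂μ, (h k p).re ≤ 0)
    (hae : ∀ᵐ p ∂μ, Tendsto (fun k => h k p) atTop (𝓝 0))
    (hlim : ∀ A, MeasurableSet A → ∃ l, Tendsto (fun k => Complex.exp (∫ p in A, h k p ∂μ)) atTop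
      (𝓝 l)) :
    Tendsto (fun k => Complex.exp (∫ p, h k p ∂μ)) atTop (𝓝 1) := by
  obtain ⟨w, hwpos, hwm, hwint⟩ := exists_pos_lintegral_lt_of_sigmaFinite μ one_ne_zero
  have hwi : Integrable (fun p => (w p : ℝ)) μ := by
    refine ⟨by fun_prop, ?_⟩
    simp only [HasFiniteIntegral, NNReal.enorm_eq]
    exact hwint.trans ENNReal.one_lt_top
  have hnre : ∀ k A, (∫ p in A, h k p ∂μ).re ≤ 0 := fun k A => by
    rw [← RCLike.re_eq_complex_re, ← integral_re (hint k).integrableOn]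
    exact integral_nonpos_of_ae (ae_restrict_of_ae (hre k))
  -- On `G N` all later integrands are dominated by the fixed integrable weight `w`.
  let G : ℕ → Set T := fun N => {p | ∀ k, N ≤ k → ‖h k p‖ ≤ w p}
  have hGm : ∀ N, MeasurableSet (G N) := fun N => by
    simp only [G, Set.ofPred_forall]
    exact MeasurableSet.iInter fun k => MeasurableSet.iInter fun _ =>
      measurableSet_le (hmeas k).norm (by fun_prop)
  have hGmono : Monotone G := fun N N' hN p hp k hk => hp k (hN.trans hk)
  have hGev : ∀ᵐ p ∂μ, ∀ᶠ N in atTop, p ∈ G N := by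
    filter_upwards [hae] with p hp
    have h1 := hp.norm.eventually_le_const (u := (w p : ℝ)) (by simpa using hwpos p)
    obtain ⟨N, hN⟩ := eventually_atTop.1 h1
    filter_upwards [eventually_ge_atTop N] with N' hN' k hk using hN k (hN'.trans hk)
  have ha : ∀ N, Tendsto (fun k => ∫ p in G N, ‖h k p‖ ∂μ) atTop (𝓝 0) := by
    intro N
    have h1 := tendsto_integral_filter_of_dominated_convergence (μ := μ.restrict (G N))
      (l := atTop) (F := fun k p => ‖h k p‖) (f := fun _ => 0) (fun p => (w p : ℝ))
      (Eventually.of_forall fun k => ((hmeas k).norm).aestronglyMeasurable)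
      (by
        filter_upwards [eventually_ge_atTop N] with k hk
        refine (ae_restrict_iff' (hGm N)).2 (ae_of_all _ fun p hp => ?_)
        simpa using hp k hk)
      hwi.integrableOn
      (ae_restrict_of_ae (hae.mono fun p hp => by simpa using hp.norm))
    simpa using h1
  have hb : ∀ k, Tendsto (fun N => ∫ p in (G N)ᶜ, ‖h k p‖ ∂μ) atTop (𝓝 0) := by
    intro k
    have h1 := tendsto_integral_filter_of_dominated_convergence (μ := μ)
      (l := atTop) (F := fun N p => (G N)ᶜ.indicator (fun p => ‖h k p‖) p) (f := fun _ => 0)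
      (fun p => ‖h k p‖)
      (Eventually.of_forall fun N =>
        ((hmeas k).norm.indicator (hGm N).compl).aestronglyMeasurable)
      (Eventually.of_forall fun N => ae_of_all _ fun p => by
        rw [Real.norm_of_nonneg (Set.indicator_nonneg (fun _ _ => norm_nonneg _) _)]
        exact Set.indicator_le_self' (fun _ _ => norm_nonneg _) p)
      (hint k).norm
      (hGev.mono fun p hp => tendsto_const_nhds.congr' (hp.mono fun N hN => by simp [hN]))
    simp_rw [integral_indicator (hGm _).compl] at h1
    simpa using h1
  obtain ⟨l, hl⟩ := hlim Set.univ MeasurableSet.univ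
  simp only [Measure.restrict_univ] at hl
  suffices l = 1 by rwa [← this]
  have key : ∀ ε : ℝ, 0 < ε → ‖l - 1‖ ≤ 4 * ε := by
    intro ε hε
    have hκ : ∀ N, ∃ k, N ≤ k ∧ ∫ p in G N, ‖h k p‖ ∂μ < ε := fun N =>
      ((eventually_ge_atTop N).and ((ha N).eventually_lt_const hε)).exists
    choose κ hκN hκ using hκ
    have hη : ∀ N, ∃ N', N < N' ∧ ∫ p in (G N')ᶜ, ‖h (κ N) p‖ ∂μ < ε := fun N =>
      ((eventually_gt_atTop N).and ((hb (κ N)).eventually_lt_const hε)).exists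
    choose η hηN hη using hη
    let N : ℕ → ℕ := fun j => η^[j] 0
    have hNs : ∀ j, N (j + 1) = η (N j) := fun j => Function.iterate_succ_apply' η j 0
    have hNmono : StrictMono N := strictMono_nat_of_lt_succ fun j => by rw [hNs]; exact hηN _
    -- The hump of `h (κ (N j))` sits on `A j` up to an error `2 ε`.
    let A : ℕ → Set T := fun j => G (N (j + 1)) \ G (N j)
    have hAm : ∀ j, MeasurableSet (A j) := fun j => (hGm _).diff (hGm _)
    have hAd : ∀ i j, i < j → Disjoint (A i) (A j) := fun i j hij =>
      Set.disjoint_left.2 fun p hp hp' => hp'.2 (hGmono (hNmono.monotone hij) hp.1)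
    have hAc : ∀ j, ∫ p in (A j)ᶜ, ‖h (κ (N j)) p‖ ∂μ ≤ 2 * ε := by
      intro j
      have h1 : (A j)ᶜ ⊆ G (N j) ∪ (G (N (j + 1)))ᶜ := fun p hp => by
        by_cases h2 : p ∈ G (N j)
        · exact Or.inl h2
        · exact Or.inr fun h3 => hp ⟨h3, h2⟩
      calc ∫ p in (A j)ᶜ, ‖h (κ (N j)) p‖ ∂μ
          ≤ ∫ p in G (N j) ∪ (G (N (j + 1)))ᶜ, ‖h (κ (N j)) p‖ ∂μ :=
            setIntegral_mono_set (hint _).norm.integrableOn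
              (ae_of_all _ fun _ => norm_nonneg _) (LE.le.eventuallyLE h1)
        _ = (∫ p in G (N j), ‖h (κ (N j)) p‖ ∂μ)
            + ∫ p in (G (N (j + 1)))ᶜ, ‖h (κ (N j)) p‖ ∂μ := by
            refine setIntegral_union ?_ (hGm _).compl (hint _).norm.integrableOn
              (hint _).norm.integrableOn
            exact Set.disjoint_compl_right_iff_subset.2 (hGmono (hNmono.monotone (Nat.le_succ j)))
        _ ≤ 2 * ε := by
            have := hη (N j)
            rw [← hNs] at this
            linarith [hκ (N j)]
    have hsmall : ∀ j B, MeasurableSet B → Disjoint B (A j) →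
        ‖∫ p in B, h (κ (N j)) p ∂μ‖ ≤ 2 * ε := fun j B hB hd => by
      refine (norm_integral_le_integral_norm _).trans (le_trans ?_ (hAc j))
      exact setIntegral_mono_set (hint _).norm.integrableOn (ae_of_all _ fun _ => norm_nonneg _)
        (LE.le.eventuallyLE (Set.disjoint_left.1 hd))
    have hκtop : Tendsto (fun j => κ (N j)) atTop atTop :=
      tendsto_atTop_mono (fun j => (hNmono.id_le j).trans (hκN _)) tendsto_id
    have h2 : Tendsto (fun j : ℕ => 2 * j) atTop atTop :=
      tendsto_atTop_mono (fun j => by simp only [id]; omega) tendsto_id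
    have h2' : Tendsto (fun j : ℕ => 2 * j + 1) atTop atTop :=
      tendsto_atTop_mono (fun j => by simp only [id]; omega) tendsto_id
    -- On `E` the even integrands keep their whole mass, the odd ones lose it.
    let E : Set T := ⋃ j, A (2 * j)
    have hE : MeasurableSet E := MeasurableSet.iUnion fun j => hAm _
    obtain ⟨e, he⟩ := hlim E hE
    have heven : ‖e - l‖ ≤ 2 * ε := by
      refine le_of_tendsto ((he.comp (hκtop.comp h2)).sub (hl.comp (hκtop.comp h2))).norm
        (Eventually.of_forall fun j => ?_)
      simp only [Function.comp]
      have h3 := hnre (κ (N (2 * j))) Set.univ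
      rw [Measure.restrict_univ] at h3
      refine (norm_exp_sub_exp_le (hnre _ _) h3).trans ?_
      rw [← integral_add_compl hE (hint _), sub_add_cancel_left, norm_neg]
      refine hsmall _ _ hE.compl (Set.disjoint_left.2 fun p hp hp' => hp ?_)
      exact Set.mem_iUnion.2 ⟨j, hp'⟩
    have hodd : ‖e - 1‖ ≤ 2 * ε := by
      refine le_of_tendsto ((he.comp (hκtop.comp h2')).sub tendsto_const_nhds).norm
        (Eventually.of_forall fun j => ?_)
      simp only [Function.comp]
      rw [← Complex.exp_zero]
      refine (norm_exp_sub_exp_le (hnre _ _) (by simp)).trans ?_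
      rw [sub_zero]
      refine hsmall _ _ hE (Set.disjoint_iUnion_left.2 fun i => ?_)
      rcases lt_or_gt_of_ne (show 2 * i ≠ 2 * j + 1 by omega) with h | h
      · exact hAd _ _ h
      · exact (hAd _ _ h).symm
    calc ‖l - 1‖ = ‖(e - 1) - (e - l)‖ := by congr 1; ring
      _ ≤ ‖e - 1‖ + ‖e - l‖ := norm_sub_le _ _
      _ ≤ 4 * ε := by linarith
  have h0 : ‖l - 1‖ ≤ 0 := by
    refine le_of_forall_pos_le_add fun ε hε => ?_
    have := key (ε / 4) (by positivity)
    linarith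
  exact sub_eq_zero.1 (norm_le_zero_iff.1 h0)

/-- If integrands with nonpositive real part tend to `0` almost everywhere and `exp (∫_A hₖ)`
converges for *every* measurable set `A`, then `exp (∫ hₖ) → 1`. Otherwise a subsequence could be
chosen whose integrands are carried, up to small errors, by disjoint sets, and the union of every
other one of these sets would contradict the convergence. -/
lemma tendsto_exp_integral_one {T : Type*} [MeasurableSpace T] {μ : Measure T}
    [SigmaFinite μ] {h : ℕ → T → ℂ}
    (hint : ∀ k, Integrable (h k) μ) (hre : ∀ k p, (h k p).re ≤ 0)
    (hae : ∀ᵐ p ∂μ, Tendsto (fun k => h k p) atTop (𝓝 0))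
    (hlim : ∀ A, MeasurableSet A → ∃ l, Tendsto (fun k => Complex.exp (∫ p in A, h k p ∂μ)) atTop
      (𝓝 l)) :
    Tendsto (fun k => Complex.exp (∫ p, h k p ∂μ)) atTop (𝓝 1) := by
  let h' : ℕ → T → ℂ := fun k => (hint k).1.mk (h k)
  have heq : ∀ k, h k =ᵐ[μ] h' k := fun k => (hint k).1.ae_eq_mk
  have h1 : ∀ k, ∫ p, h k p ∂μ = ∫ p, h' k p ∂μ := fun k => integral_congr_ae (heq k)
  have h2 : ∀ k A, ∫ p in A, h k p ∂μ = ∫ p in A, h' k p ∂μ := fun k A =>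
    integral_congr_ae (ae_restrict_of_ae (heq k))
  simp_rw [h2] at hlim
  simp_rw [h1]
  refine tendsto_exp_integral_one_of_measurable
    (fun k => (hint k).1.stronglyMeasurable_mk.measurable) (fun k => (hint k).congr (heq k))
    (fun k => (heq k).mono fun p hp => hp ▸ hre k p) ?_ hlim
  filter_upwards [hae, ae_all_iff.2 heq] with p hp hp'
  exact hp.congr hp'

lemma tendsto_integral_exp_inner_sub {Ω : Type*} [MeasurableSpace Ω] {P : Measure Ω}
    [IsProbabilityMeasure P] {n : ℕ} {X Z : ℕ → Ω → RSpace n} {Y W : Ω → RSpace n}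
    (hX : ∀ k, AEMeasurable (X k) P) (hZ : ∀ k, AEMeasurable (Z k) P)
    (hXY : TendstoInMeasure P X atTop Y) (hZW : TendstoInMeasure P Z atTop W) (u : RSpace n) :
    Tendsto (fun k => ∫ ω, Complex.exp (Complex.I * ((inner ℝ u (X k ω - Z k ω) : ℝ) : ℂ)) ∂P)
      atTop (𝓝 (∫ ω, Complex.exp (Complex.I * ((inner ℝ u (Y ω - W ω) : ℝ) : ℂ)) ∂P)) := by
  refine tendsto_of_subseq_tendsto fun ns hns => ?_
  obtain ⟨ms, hms, h1⟩ := (hXY.comp hns).exists_seq_tendsto_ae'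
  obtain ⟨ls, hls, h2⟩ := (hZW.comp (hns.comp hms)).exists_seq_tendsto_ae'
  refine ⟨ms ∘ ls, tendsto_integral_of_dominated_convergence (fun _ => 1)
    (fun k => ?_) (integrable_const _) (fun k => ae_of_all _ fun ω => ?_) ?_⟩
  · have := hX (ns ((ms ∘ ls) k))
    have := hZ (ns ((ms ∘ ls) k))
    fun_prop
  · rw [mul_comm, Complex.norm_exp_ofReal_mul_I]
  · filter_upwards [h1, h2] with ω hω1 hω2
    have h3 := (hω1.comp hls).sub hω2
    have hc : Continuous fun x : RSpace n => Complex.exp (Complex.I * ((inner ℝ u x : ℝ) : ℂ)) := by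
      fun_prop
    exact (hc.tendsto _).comp h3

lemma ae_eq_of_charFun_sub_eq_one {Ω : Type*} [MeasurableSpace Ω] {P : Measure Ω}
    [IsProbabilityMeasure P] {n : ℕ} {Y W : Ω → RSpace n} (hY : AEMeasurable Y P)
    (hW : AEMeasurable W P)
    (h : ∀ u : RSpace n,
      ∫ ω, Complex.exp (Complex.I * ((inner ℝ u (Y ω - W ω) : ℝ) : ℂ)) ∂P = 1) :
    Y =ᵐ[P] W := by
  have hD : AEMeasurable (fun ω => Y ω - W ω) P := hY.sub hW
  have := Measure.isProbabilityMeasure_map hD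
  have hmap : P.map (fun ω => Y ω - W ω) = Measure.dirac 0 := by
    refine Measure.ext_of_charFun ?_
    ext u
    rw [charFun_apply, integral_map hD (by fun_prop), charFun_dirac]
    simp only [inner_zero_left, Complex.ofReal_zero, zero_mul, Complex.exp_zero]
    rw [← h u]
    simp only [mul_comm Complex.I, real_inner_comm u]
  have h0 : ∀ᵐ x ∂(P.map fun ω => Y ω - W ω), x = 0 := by
    rw [hmap, ae_dirac_eq]
    simp
  filter_upwards [ae_of_ae_map hD h0] with ω hω using sub_eq_zero.1 hω

section LevyBasis

variable {Ω S : Type*} [MeasurableSpace Ω] {P : Measure Ω} [MetricSpace S] [MeasurableSpace S]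
  {m d n : ℕ} {L : Set (S × RSpace m) → Ω → RSpace d}
  {γ : RSpace d} {Sig : Matrix (Fin d) (Fin d) ℝ} {ν : Measure (RSpace d)} {π : Measure S}

/-- The stochastic integral does not depend on the approximating simple kernels. -/
theorem IsStochasticIntegral.ae_eq [IsProbabilityMeasure P] (hL : IsLevyBasis P L)
    (hquad : HasCharacteristicQuadruplet P L γ Sig ν π)
    (hmoment : ∫⁻ x in {x | 1 < ‖x‖}, ENNReal.ofReal (‖x‖ ^ 2) ∂ν < ∞)
    (hcentered : γ + ∫ x in {x | 1 < ‖x‖}, x ∂ν = 0)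
    {f : S × RSpace m → Matrix (Fin n) (Fin d) ℝ} {Y W : Ω → RSpace n}
    (hY : IsStochasticIntegral P π L f Y) (hW : IsStochasticIntegral P π L f W) :
    Y =ᵐ[P] W := by
  have := hquad.isProbabilityMeasure
  obtain ⟨K, hK0, hK⟩ := exists_norm_cumulant_le hquad.posSemidef hquad.isLevyMeasure hmoment
    hcentered
  obtain ⟨-, hYm, φ, hφ, hφA, hφY⟩ := hY
  obtain ⟨-, hWm, ψ, hψ, hψA, hψW⟩ := hW
  refine ae_eq_of_charFun_sub_eq_one hYm hWm fun u => ?_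
  have hset : ∀ k A, MeasurableSet A →
      ∫ ω, Complex.exp (Complex.I *
        ((inner ℝ u ((φ k).integral L A ω - (ψ k).integral L A ω) : ℝ) : ℂ)) ∂P
      = Complex.exp (∫ p in A, cumulant γ Sig ν
          (matVec ((φ k).toFun p - (ψ k).toFun p).transpose u) ∂(π.prod volume)) := by
    intro k A hA
    rw [integral_exp_inner_sub_eq hL hquad _ _ hA hA, ← integral_indicator hA]
    congr 2 with p
    by_cases hp : p ∈ A
    · simp [hp]
    · simp [hp, matVec_zero_left, cumulant_zero]
  have hlim := tendsto_exp_integral_one (μ := π.prod (volume : Measure (RSpace m)))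
    (h := fun k p => cumulant γ Sig ν (matVec ((φ k).toFun p - (ψ k).toFun p).transpose u))
    (fun k => by
      simpa using integrable_cumulant_matVec_sub (φ k) (ψ k) MeasurableSet.univ
        MeasurableSet.univ u)
    (fun k p => (hK _).2) ?_ fun A hA => ?_
  · have h1 := tendsto_integral_exp_inner_sub (fun k => aemeasurable_integral hL _ .univ)
      (fun k => aemeasurable_integral hL _ .univ) hφY hψW u
    simp_rw [hset _ _ MeasurableSet.univ, Measure.restrict_univ] at h1
    exact tendsto_nhds_unique h1 hlim
  · filter_upwards [hφ, hψ] with p hp hp'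
    have h1 := ((continuous_matVec_transpose u).tendsto _).comp (hp.sub hp')
    rw [sub_self, Matrix.transpose_zero, matVec_zero_left] at h1
    have h2 := (h1.norm.pow 2).const_mul K
    rw [norm_zero, zero_pow two_ne_zero, mul_zero] at h2
    exact squeeze_zero_norm (fun k => (hK _).1) h2
  · obtain ⟨YA, -, hYA⟩ := hφA A hA
    obtain ⟨WA, -, hWA⟩ := hψA A hA
    have h1 := tendsto_integral_exp_inner_sub (fun k => aemeasurable_integral hL _ hA)
      (fun k => aemeasurable_integral hL _ hA) hYA hWA u
    simp_rw [hset _ _ hA] at h1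
    exact ⟨_, h1⟩

end LevyBasis

/-! ### Square integrable kernels -/

section Approximation

variable {T : Type*} {n d : ℕ}

/-- The simple kernel which equals the simple function `s` on `K` and vanishes off `K`. -/
noncomputable def SimpleKernel.ofSimpleFunc [Bornology T] [MeasurableSpace T]
    (s : SimpleFunc T (Fin n → Fin d → ℝ)) {K : Set T} (hK : IsBddBorel K) :
    SimpleKernel T n d where
  size := s.range.card
  coeff j := Matrix.of (s.range.equivFin.symm j).1
  sets j := s ⁻¹' {(s.range.equivFin.symm j).1} ∩ K
  bddBorel j := hK.inter_left (s.measurableSet_preimage _)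
  disjoint i j hij := Set.disjoint_left.2 fun p hp hp' => hij <| by
    have h1 : s p = (s.range.equivFin.symm i).1 := hp.1
    have h2 : s p = (s.range.equivFin.symm j).1 := hp'.1
    exact s.range.equivFin.symm.injective (Subtype.ext (h1.symm.trans h2))

lemma SimpleKernel.ofSimpleFunc_toFun [Bornology T] [MeasurableSpace T]
    (s : SimpleFunc T (Fin n → Fin d → ℝ)) {K : Set T} (hK : IsBddBorel K) (p : T) :
    (SimpleKernel.ofSimpleFunc s hK).toFun p = K.indicator (fun p => Matrix.of (s p)) p := by
  unfold SimpleKernel.toFun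
  let j₀ : Fin s.range.card := s.range.equivFin ⟨s p, s.mem_range_self p⟩
  have hj₀ : (s.range.equivFin.symm j₀).1 = s p := by simp [j₀]
  refine (Finset.sum_eq_single j₀ (fun j _ hj => ?_)
    (fun h => absurd (Finset.mem_univ _) h)).trans ?_
  · refine Set.indicator_of_notMem (fun hp => hj ?_) _
    have h1 : s p = (s.range.equivFin.symm j).1 := hp.1
    exact s.range.equivFin.symm.injective (Subtype.ext (h1.symm.trans hj₀.symm))
  · by_cases hp : p ∈ K
    · rw [Set.indicator_of_mem hp, Set.indicator_of_mem]
      · exact congrArg Matrix.of hj₀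
      · exact ⟨hj₀.symm, hp⟩
    · rw [Set.indicator_of_notMem hp, Set.indicator_of_notMem fun h => hp h.2]

lemma norm_sq_le_frobSq (A : Fin n → Fin d → ℝ) : ‖A‖ ^ 2 ≤ frobSq (Matrix.of A) := by
  have h : ‖A‖ ≤ √(frobSq (Matrix.of A)) := by
    refine (pi_norm_le_iff_of_nonneg (Real.sqrt_nonneg _)).2 fun i =>
      (pi_norm_le_iff_of_nonneg (Real.sqrt_nonneg _)).2 fun j => ?_
    refine Real.le_sqrt_of_sq_le ?_
    rw [Real.norm_eq_abs, sq_abs]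
    calc A i j ^ 2 ≤ ∑ j, A i j ^ 2 :=
          Finset.single_le_sum (f := fun j => A i j ^ 2) (fun _ _ => sq_nonneg _)
            (Finset.mem_univ j)
      _ ≤ _ := Finset.single_le_sum (f := fun i => ∑ j, A i j ^ 2)
          (fun _ _ => Finset.sum_nonneg fun _ _ => sq_nonneg _) (Finset.mem_univ i)
  calc ‖A‖ ^ 2 ≤ √(frobSq (Matrix.of A)) ^ 2 := by gcongr
    _ = _ := Real.sq_sqrt (frobSq_nonneg _)

lemma frobSq_le_norm_sq (A : Fin n → Fin d → ℝ) : frobSq (Matrix.of A) ≤ n * d * ‖A‖ ^ 2 := by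
  calc frobSq (Matrix.of A) ≤ ∑ _i : Fin n, ∑ _j : Fin d, ‖A‖ ^ 2 := by
        refine Finset.sum_le_sum fun i _ => Finset.sum_le_sum fun j _ => ?_
        rw [Matrix.of_apply, ← sq_abs]
        gcongr
        exact (norm_le_pi_norm (A i) j).trans (norm_le_pi_norm A i)
    _ = _ := by simp [mul_assoc]

lemma measurable_frobSq_comp [MeasurableSpace T] {f : T → Matrix (Fin n) (Fin d) ℝ}
    (hf : ∀ i j, Measurable fun p => f p i j) : Measurable fun p => frobSq (f p) := by
  unfold frobSq
  fun_prop

lemma SimpleKernel.measurable_toFun_apply [Bornology T] [MeasurableSpace T]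
    (φ : SimpleKernel T n d) (i : Fin n) (j : Fin d) : Measurable fun p => φ.toFun p i j := by
  have h : ∀ p, φ.toFun p i j = ∑ k, (φ.sets k).indicator (fun _ => φ.coeff k i j) p := by
    intro p
    rw [SimpleKernel.toFun, Matrix.sum_apply]
    refine Finset.sum_congr rfl fun k _ => ?_
    by_cases hp : p ∈ φ.sets k <;> simp [hp]
  simp_rw [h]
  exact Finset.measurable_sum _ fun k _ => measurable_const.indicator (φ.bddBorel k).2

/-- Square integrable kernels are limits of simple kernels, pointwise and in `L²`. -/
lemma exists_simpleKernel_tendsto [PseudoMetricSpace T] [Nonempty T] [MeasurableSpace T]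
    [OpensMeasurableSpace T] {μ : Measure T} {f : T → Matrix (Fin n) (Fin d) ℝ}
    (hf : ∀ i j, Measurable fun p => f p i j)
    (hf2 : ∫⁻ p, ENNReal.ofReal (frobSq (f p)) ∂μ < ∞) :
    ∃ ψ : ℕ → SimpleKernel T n d, (∀ p, Tendsto (fun k => (ψ k).toFun p) atTop (𝓝 (f p))) ∧
      Tendsto (fun k => ∫⁻ p, ENNReal.ofReal (frobSq ((ψ k).toFun p - f p)) ∂μ) atTop (𝓝 0) := by
  let f' : T → Fin n → Fin d → ℝ := fun p i j => f p i j
  have hf' : Measurable f' := measurable_pi_lambda _ fun i => measurable_pi_lambda _ fun j => hf i j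
  let x₀ : T := Classical.arbitrary T
  have hK : ∀ k : ℕ, IsBddBorel (Metric.closedBall x₀ k) := fun k =>
    ⟨Metric.isBounded_closedBall, Metric.isClosed_closedBall.measurableSet⟩
  let s : ℕ → SimpleFunc T (Fin n → Fin d → ℝ) := fun k =>
    SimpleFunc.approxOn f' hf' Set.univ 0 (Set.mem_univ _) k
  let ψ : ℕ → SimpleKernel T n d := fun k => SimpleKernel.ofSimpleFunc (s k) (hK k)
  have hψ : ∀ k p, (ψ k).toFun p
      = (Metric.closedBall x₀ (k : ℝ)).indicator (fun p => Matrix.of (s k p)) p := fun k p =>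
    SimpleKernel.ofSimpleFunc_toFun _ _ _
  have hlim : ∀ p, Tendsto (fun k => (ψ k).toFun p) atTop (𝓝 (f p)) := by
    intro p
    have h1 : Tendsto (fun k => s k p) atTop (𝓝 (f' p)) :=
      SimpleFunc.tendsto_approxOn hf' (Set.mem_univ _) (by simp)
    refine Tendsto.congr' ?_ h1
    obtain ⟨N, hN⟩ := exists_nat_ge (dist p x₀)
    filter_upwards [eventually_ge_atTop N] with k hk
    rw [hψ, Set.indicator_of_mem]
    · rfl
    · exact Metric.mem_closedBall.2 (hN.trans (by exact_mod_cast hk))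
  have hbound : ∀ k p, frobSq ((ψ k).toFun p - f p) ≤ (8 * (n * d) + 2) * frobSq (f p) := by
    intro k p
    have h1 : frobSq ((ψ k).toFun p) ≤ 4 * (n * d) * frobSq (f p) := by
      have h0 : 0 ≤ 4 * (n * d : ℝ) * frobSq (f p) := mul_nonneg (by positivity) (frobSq_nonneg _)
      rw [hψ]
      by_cases hp : p ∈ Metric.closedBall x₀ (k : ℝ)
      · rw [Set.indicator_of_mem hp]
        have h2 : ‖s k p‖ ≤ ‖f' p‖ + ‖f' p‖ :=
          SimpleFunc.norm_approxOn_zero_le hf' (Set.mem_univ _) p k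
        calc frobSq (Matrix.of (s k p)) ≤ n * d * ‖s k p‖ ^ 2 := frobSq_le_norm_sq _
          _ ≤ n * d * (‖f' p‖ + ‖f' p‖) ^ 2 := by gcongr
          _ = 4 * (n * d) * ‖f' p‖ ^ 2 := by ring
          _ ≤ _ := by
            gcongr
            exact norm_sq_le_frobSq (f' p)
      · rw [Set.indicator_of_notMem hp, frobSq_zero]
        exact h0
    linarith [frobSq_sub_le ((ψ k).toFun p) (f p)]
  refine ⟨ψ, hlim, ?_⟩
  have h := tendsto_lintegral_of_dominated_convergence (μ := μ)
    (F := fun k p => ENNReal.ofReal (frobSq ((ψ k).toFun p - f p))) (f := fun _ => 0)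
    (fun p => ENNReal.ofReal (8 * (n * d) + 2) * ENNReal.ofReal (frobSq (f p)))
    (fun k => (measurable_frobSq_comp fun i j =>
      ((ψ k).measurable_toFun_apply i j).sub (hf i j)).ennreal_ofReal)
    (fun k => ae_of_all _ fun p => by
      simp only
      rw [← ENNReal.ofReal_mul (by positivity)]
      exact ENNReal.ofReal_le_ofReal (hbound k p))
    (by
      rw [lintegral_const_mul' _ _ ENNReal.ofReal_ne_top]
      exact ENNReal.mul_ne_top ENNReal.ofReal_ne_top hf2.ne)
    (ae_of_all _ fun p => by
      have h1 := ((continuous_frobSq.tendsto _).comp ((hlim p).sub_const (f p)))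
      rw [sub_self, frobSq_zero] at h1
      simpa using ENNReal.tendsto_ofReal h1)
  simpa using h

end Approximation

lemma eLpNorm_two_le_rpow {Ω : Type*} [MeasurableSpace Ω] {P : Measure Ω} {n : ℕ}
    {f : Ω → RSpace n} {D : ℝ≥0∞} (h : ∫⁻ ω, ‖f ω‖ₑ ^ 2 ∂P ≤ D) :
    eLpNorm f 2 P ≤ D ^ (1 / 2 : ℝ) := by
  rw [eLpNorm_eq_lintegral_rpow_enorm_toReal two_ne_zero ENNReal.ofNat_ne_top]
  simp only [ENNReal.toReal_ofNat, ENNReal.rpow_two]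
  gcongr

lemma ofReal_frobSq_sub_le {n d : ℕ} (A B : Matrix (Fin n) (Fin d) ℝ) :
    ENNReal.ofReal (frobSq (A - B))
      ≤ 2 * ENNReal.ofReal (frobSq A) + 2 * ENNReal.ofReal (frobSq B) := by
  have h2 : (2 : ℝ≥0∞) = ENNReal.ofReal 2 := by simp
  rw [h2, ← ENNReal.ofReal_mul zero_le_two, ← ENNReal.ofReal_mul zero_le_two,
    ← ENNReal.ofReal_add (mul_nonneg zero_le_two (frobSq_nonneg _))
      (mul_nonneg zero_le_two (frobSq_nonneg _))]
  exact ENNReal.ofReal_le_ofReal (frobSq_sub_le A B)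

section LevyBasis

variable {Ω S : Type*} [MeasurableSpace Ω] {P : Measure Ω} [MetricSpace S] [MeasurableSpace S]
  {m d n : ℕ} {L : Set (S × RSpace m) → Ω → RSpace d}
  {γ : RSpace d} {Sig : Matrix (Fin d) (Fin d) ℝ} {ν : Measure (RSpace d)} {π : Measure S}

lemma memLp_integral [IsProbabilityMeasure P] (hL : IsLevyBasis P L)
    (hquad : HasCharacteristicQuadruplet P L γ Sig ν π)
    (hmoment : ∫⁻ x in {x | 1 < ‖x‖}, ENNReal.ofReal (‖x‖ ^ 2) ∂ν < ∞)
    (hcentered : γ + ∫ x in {x | 1 < ‖x‖}, x ∂ν = 0) (φ : SimpleKernel (S × RSpace m) n d)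
    (hφ : ∫⁻ p, ENNReal.ofReal (frobSq (φ.toFun p)) ∂(π.prod volume) < ∞)
    {A : Set (S × RSpace m)} (hA : MeasurableSet A) : MemLp (φ.integral L A) 2 P := by
  obtain ⟨K, hK0, hK⟩ := exists_lintegral_sq_norm_sub_le hL hquad hmoment hcentered n
  refine ⟨(aemeasurable_integral hL φ hA).aestronglyMeasurable, ?_⟩
  have hempty : ∀ᵐ ω ∂P, φ.integral L ∅ ω = 0 := by
    filter_upwards [hL.ae_empty_eq_zero] with ω hω
    simp only [SimpleKernel.integral, Set.empty_inter, hω]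
    exact Finset.sum_eq_zero fun j _ => by ext i; simp [matVec]
  have h := hK φ φ A ∅ hA .empty
  refine lt_of_le_of_lt (eLpNorm_two_le_rpow (le_trans (le_of_eq ?_) (h.trans (mul_le_mul_right
    (lintegral_mono fun p => ENNReal.ofReal_le_ofReal (?_ : _ ≤ frobSq (φ.toFun p))) _)))) ?_
  · refine lintegral_congr_ae ?_
    filter_upwards [hempty] with ω hω
    rw [hω, sub_zero]
  · by_cases hp : p ∈ A
    · simp [hp]
    · simp [hp, frobSq_zero, frobSq_nonneg]
  · exact ENNReal.rpow_lt_top_of_nonneg (by norm_num)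
      (ENNReal.mul_ne_top ENNReal.ofReal_ne_top hφ.ne)

/-- A square integrable kernel is integrable, and its integral can be reached in `L²` by simple
kernels that approximate it in `L²`. -/
theorem exists_tendsto_stochasticIntegral [IsProbabilityMeasure P]
    [OpensMeasurableSpace (S × RSpace m)] (hL : IsLevyBasis P L)
    (hquad : HasCharacteristicQuadruplet P L γ Sig ν π)
    (hmoment : ∫⁻ x in {x | 1 < ‖x‖}, ENNReal.ofReal (‖x‖ ^ 2) ∂ν < ∞)
    (hcentered : γ + ∫ x in {x | 1 < ‖x‖}, x ∂ν = 0)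
    {f : S × RSpace m → Matrix (Fin n) (Fin d) ℝ} (hf : ∀ i j, Measurable fun p => f p i j)
    (hf2 : ∫⁻ p, ENNReal.ofReal (frobSq (f p)) ∂(π.prod volume) < ∞) :
    ∃ (ψ : ℕ → SimpleKernel (S × RSpace m) n d) (Z : Ω → RSpace n),
      IsStochasticIntegral P π L f Z ∧
      Tendsto (fun k => ∫⁻ p, ENNReal.ofReal (frobSq ((ψ k).toFun p - f p)) ∂(π.prod volume))
        atTop (𝓝 0) ∧
      Tendsto (fun k => eLpNorm ((ψ k).integral L Set.univ - Z) 2 P) atTop (𝓝 0) := by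
  have := hquad.isProbabilityMeasure
  have : Nonempty S := nonempty_of_isProbabilityMeasure π
  obtain ⟨K, hK0, hK⟩ := exists_lintegral_sq_norm_sub_le hL hquad hmoment hcentered n
  obtain ⟨ψ₀, hψ₀, hψ₀2⟩ := exists_simpleKernel_tendsto hf hf2
  -- A subsequence whose squared `L²` errors decay geometrically.
  obtain ⟨ns, hns, hns2⟩ := extraction_forall_of_eventually
    (P := fun k N => ∫⁻ p, ENNReal.ofReal (frobSq ((ψ₀ N).toFun p - f p)) ∂(π.prod volume)
      < (1 / 4 : ℝ≥0∞) ^ k)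
    (fun k => hψ₀2.eventually_lt_const (pos_iff_ne_zero.2 (pow_ne_zero _ (by simp))))
  let ψ : ℕ → SimpleKernel (S × RSpace m) n d := fun k => ψ₀ (ns k)
  have hdist : ∀ N k l, N ≤ k → N ≤ l →
      ∫⁻ p, ENNReal.ofReal (frobSq ((ψ k).toFun p - (ψ l).toFun p)) ∂(π.prod volume)
        ≤ 4 * (1 / 4 : ℝ≥0∞) ^ N := by
    intro N k l hk hl
    have hle : ∀ k, N ≤ k →
        ∫⁻ p, ENNReal.ofReal (frobSq ((ψ k).toFun p - f p)) ∂(π.prod volume)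
          ≤ (1 / 4 : ℝ≥0∞) ^ N := fun k hk =>
      (hns2 k).le.trans (pow_le_pow_right_of_le_one' (by
        rw [one_div]; exact ENNReal.inv_le_one.2 (by norm_num)) hk)
    calc _ ≤ ∫⁻ p, (2 * ENNReal.ofReal (frobSq ((ψ k).toFun p - f p))
            + 2 * ENNReal.ofReal (frobSq ((ψ l).toFun p - f p))) ∂(π.prod volume) := by
          refine lintegral_mono fun p => ?_
          have := ofReal_frobSq_sub_le ((ψ k).toFun p - f p) ((ψ l).toFun p - f p)
          rwa [sub_sub_sub_cancel_right] at this
      _ = 2 * (∫⁻ p, ENNReal.ofReal (frobSq ((ψ k).toFun p - f p)) ∂(π.prod volume))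
            + 2 * ∫⁻ p, ENNReal.ofReal (frobSq ((ψ l).toFun p - f p)) ∂(π.prod volume) := by
          rw [lintegral_add_left', lintegral_const_mul' _ _ (by simp),
            lintegral_const_mul' _ _ (by simp)]
          exact ((measurable_frobSq_comp fun i j =>
            ((ψ k).measurable_toFun_apply i j).sub
              (hf i j)).ennreal_ofReal.const_mul _).aemeasurable
      _ ≤ 2 * (1 / 4 : ℝ≥0∞) ^ N + 2 * (1 / 4 : ℝ≥0∞) ^ N := by
          gcongr
          · exact hle k hk
          · exact hle l hl
      _ = _ := by ring
  have hψfin : ∀ k, ∫⁻ p, ENNReal.ofReal (frobSq ((ψ k).toFun p)) ∂(π.prod volume) < ∞ := by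
    intro k
    calc _ ≤ ∫⁻ p, (2 * ENNReal.ofReal (frobSq ((ψ k).toFun p - f p))
            + 2 * ENNReal.ofReal (frobSq (f p))) ∂(π.prod volume) := by
          refine lintegral_mono fun p => ?_
          have := ofReal_frobSq_sub_le ((ψ k).toFun p - f p) (-f p)
          rwa [frobSq_neg, sub_neg_eq_add, sub_add_cancel] at this
      _ = 2 * (∫⁻ p, ENNReal.ofReal (frobSq ((ψ k).toFun p - f p)) ∂(π.prod volume))
            + 2 * ∫⁻ p, ENNReal.ofReal (frobSq (f p)) ∂(π.prod volume) := by
          rw [lintegral_add_left', lintegral_const_mul' _ _ (by simp),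
            lintegral_const_mul' _ _ (by simp)]
          exact ((measurable_frobSq_comp fun i j =>
            ((ψ k).measurable_toFun_apply i j).sub
              (hf i j)).ennreal_ofReal.const_mul _).aemeasurable
      _ < ∞ := by
          refine ENNReal.add_lt_top.2 ⟨ENNReal.mul_lt_top (by simp) ((hns2 k).trans_le ?_),
            ENNReal.mul_lt_top (by simp) hf2⟩
          exact le_top
  have hconv : ∀ A, MeasurableSet A → ∃ Z : Ω → RSpace n, MemLp Z 2 P ∧
      Tendsto (fun k => eLpNorm ((ψ k).integral L A - Z) 2 P) atTop (𝓝 0) := by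
    intro A hA
    let C : ℝ≥0∞ := (ENNReal.ofReal K * 4) ^ (1 / 2 : ℝ)
    have hC : C ≠ ∞ := ENNReal.rpow_ne_top_of_nonneg (by norm_num)
      (ENNReal.mul_ne_top ENNReal.ofReal_ne_top (by simp))
    refine Lp.cauchy_complete_eLpNorm (by norm_num)
      (fun k => memLp_integral hL hquad hmoment hcentered (ψ k) (hψfin k) hA)
      (B := fun N => (C + 1) * (1 / 2 : ℝ≥0∞) ^ N) ?_ fun N k l hk hl => ?_
    · rw [ENNReal.tsum_mul_left, ENNReal.tsum_geometric]
      refine ENNReal.mul_ne_top (by simp [hC]) ?_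
      simp
    · have h1 : ∫⁻ ω, ‖((ψ k).integral L A - (ψ l).integral L A) ω‖ₑ ^ 2 ∂P
          ≤ (ENNReal.ofReal K * 4) * (1 / 4 : ℝ≥0∞) ^ N := by
        refine (hK (ψ k) (ψ l) A A hA hA).trans ?_
        rw [mul_assoc]
        gcongr
        refine le_trans (lintegral_mono fun p => ENNReal.ofReal_le_ofReal ?_) (hdist N k l hk hl)
        by_cases hp : p ∈ A
        · simp [hp]
        · simp [hp, frobSq_zero, frobSq_nonneg]
      refine lt_of_le_of_lt (eLpNorm_two_le_rpow h1) ?_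
      have h2 : ((1 / 4 : ℝ≥0∞) ^ N) ^ (1 / 2 : ℝ) = (1 / 2 : ℝ≥0∞) ^ N := by
        have h4 : (1 / 4 : ℝ≥0∞) = (1 / 2) ^ (2 : ℝ) := by
          rw [ENNReal.rpow_two, one_div, one_div, ← ENNReal.inv_pow]
          norm_num
        rw [h4, ← ENNReal.rpow_natCast, ← ENNReal.rpow_natCast, ← ENNReal.rpow_mul,
          ← ENNReal.rpow_mul]
        congr 1
        ring
      rw [ENNReal.mul_rpow_of_nonneg _ _ (by norm_num), h2]
      have hpow : (1 / 2 : ℝ≥0∞) ^ N ≠ ∞ := ENNReal.pow_ne_top (by simp)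
      have hpow0 : (1 / 2 : ℝ≥0∞) ^ N ≠ 0 := pow_ne_zero _ (by simp)
      exact ENNReal.mul_lt_mul_left hpow0 hpow (ENNReal.lt_add_right hC one_ne_zero)
  have hmeas : ∀ A, MeasurableSet A → ∀ {Z : Ω → RSpace n}, MemLp Z 2 P →
      Tendsto (fun k => eLpNorm ((ψ k).integral L A - Z) 2 P) atTop (𝓝 0) →
      TendstoInMeasure P (fun k => (ψ k).integral L A) atTop Z := fun A hA Z hZ h =>
    tendstoInMeasure_of_tendsto_eLpNorm two_ne_zero
      (fun k => (aemeasurable_integral hL _ hA).aestronglyMeasurable) hZ.1 h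
  obtain ⟨Z, hZ, hZlim⟩ := hconv Set.univ .univ
  refine ⟨ψ, Z, ⟨hf, hZ.1.aemeasurable, ψ, ?_, ?_, hmeas _ .univ hZ hZlim⟩,
    hψ₀2.comp hns.tendsto_atTop, hZlim⟩
  · exact ae_of_all _ fun p => (hψ₀ p).comp hns.tendsto_atTop
  · intro A hA
    obtain ⟨Y, hY, hYlim⟩ := hconv A hA
    exact ⟨Y, hY.1.aemeasurable, hmeas A hA hY hYlim⟩

/-- The integral over a set `U` of a suitable simple kernel approximates the full stochastic
integral of `f` in mean, up to the `L²`-mass of `f` outside `U`. -/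
theorem exists_lintegral_norm_sub_integral_le [IsProbabilityMeasure P]
    [OpensMeasurableSpace (S × RSpace m)] (hL : IsLevyBasis P L)
    (hquad : HasCharacteristicQuadruplet P L γ Sig ν π)
    (hmoment : ∫⁻ x in {x | 1 < ‖x‖}, ENNReal.ofReal (‖x‖ ^ 2) ∂ν < ∞)
    (hcentered : γ + ∫ x in {x | 1 < ‖x‖}, x ∂ν = 0) (n : ℕ) :
    ∃ K : ℝ, 0 < K ∧ ∀ (f : S × RSpace m → Matrix (Fin n) (Fin d) ℝ) (Y : Ω → RSpace n),
      IsStochasticIntegral P π L f Y →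
      ∫⁻ p, ENNReal.ofReal (frobSq (f p)) ∂(π.prod volume) < ∞ →
      ∀ U, MeasurableSet U → ∀ ε : ℝ≥0∞, 0 < ε →
      ∃ ψ : SimpleKernel (S × RSpace m) n d, ∫⁻ ω, ‖Y ω - ψ.integral L U ω‖ₑ ∂P
        ≤ (ENNReal.ofReal K * ∫⁻ p in Uᶜ, ENNReal.ofReal (frobSq (f p)) ∂(π.prod volume))
          ^ (1 / 2 : ℝ) + ε := by
  obtain ⟨K, hK0, hK⟩ := exists_lintegral_sq_norm_sub_le hL hquad hmoment hcentered n
  refine ⟨K * 2, by positivity, fun f Y hY hf2 U hU ε hε => ?_⟩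
  have hf := hY.1
  obtain ⟨ψ, Z, hZ, hψ, hψZ⟩ := exists_tendsto_stochasticIntegral hL hquad hmoment hcentered hf hf2
  have hYZ : Y =ᵐ[P] Z := hY.ae_eq hL hquad hmoment hcentered hZ
  set D : ℕ → ℝ≥0∞ := fun k =>
    ∫⁻ p, ENNReal.ofReal (frobSq ((ψ k).toFun p - f p)) ∂(π.prod volume)
  set x : ℝ≥0∞ := ∫⁻ p in Uᶜ, ENNReal.ofReal (frobSq (f p)) ∂(π.prod volume) with hx
  have herr : Tendsto (fun k => eLpNorm ((ψ k).integral L Set.univ - Z) 2 P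
      + (ENNReal.ofReal (K * 2) * D k) ^ (1 / 2 : ℝ)) atTop (𝓝 0) := by
    have h1 : Tendsto (fun k => ENNReal.ofReal (K * 2) * D k) atTop (𝓝 0) := by
      simpa using ENNReal.Tendsto.const_mul hψ (Or.inr ENNReal.ofReal_ne_top)
    have h2 := (ENNReal.continuous_rpow_const (y := (1 / 2 : ℝ))).tendsto 0 |>.comp h1
    rw [ENNReal.zero_rpow_of_pos (by norm_num)] at h2
    simpa using hψZ.add h2
  obtain ⟨k, hk⟩ := (herr.eventually_lt_const hε).exists
  have hUm := aemeasurable_integral hL (ψ k) hU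
  have hTm := aemeasurable_integral hL (ψ k) MeasurableSet.univ
  refine ⟨ψ k, ?_⟩
  have htail : ∫⁻ ω, ‖((ψ k).integral L Set.univ - (ψ k).integral L U) ω‖ₑ ^ 2 ∂P
      ≤ ENNReal.ofReal (K * 2) * D k + ENNReal.ofReal (K * 2) * x := by
    refine (hK (ψ k) (ψ k) Set.univ U .univ hU).trans ?_
    rw [ENNReal.ofReal_mul hK0.le, ← mul_add, mul_assoc]
    refine mul_le_mul_right ?_ _
    rw [hx, ← lintegral_indicator hU.compl, ← lintegral_add_left,
      ← lintegral_const_mul' _ _ ENNReal.ofReal_ne_top]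
    · refine lintegral_mono fun p => ?_
      by_cases hp : p ∈ U
      · simp [hp, frobSq_zero]
      · simp only [hp, Set.indicator_univ, Set.indicator_of_notMem, not_false_eq_true, sub_zero,
          Set.mem_compl_iff, Set.indicator_of_mem, ENNReal.ofReal_ofNat, mul_add]
        have := ofReal_frobSq_sub_le ((ψ k).toFun p - f p) (-f p)
        rwa [frobSq_neg, sub_neg_eq_add, sub_add_cancel] at this
    · exact (measurable_frobSq_comp fun i j =>
        ((ψ k).measurable_toFun_apply i j).sub (hf i j)).ennreal_ofReal
  calc ∫⁻ ω, ‖Y ω - (ψ k).integral L U ω‖ₑ ∂P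
      = eLpNorm (Z - (ψ k).integral L U) 1 P := by
        rw [eLpNorm_one_eq_lintegral_enorm]
        refine lintegral_congr_ae (hYZ.mono fun ω hω => ?_)
        simp only [Pi.sub_apply, hω]
    _ ≤ eLpNorm (Z - (ψ k).integral L U) 2 P :=
        eLpNorm_le_eLpNorm_of_exponent_le (by norm_num)
          (hZ.2.1.sub hUm).aestronglyMeasurable
    _ = eLpNorm ((Z - (ψ k).integral L Set.univ)
          + ((ψ k).integral L Set.univ - (ψ k).integral L U)) 2 P := by
        rw [sub_add_sub_cancel]
    _ ≤ eLpNorm (Z - (ψ k).integral L Set.univ) 2 P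
          + eLpNorm ((ψ k).integral L Set.univ - (ψ k).integral L U) 2 P :=
        eLpNorm_add_le (hZ.2.1.sub hTm).aestronglyMeasurable
          (hTm.sub hUm).aestronglyMeasurable (by norm_num)
    _ ≤ eLpNorm ((ψ k).integral L Set.univ - Z) 2 P
          + ((ENNReal.ofReal (K * 2) * D k) ^ (1 / 2 : ℝ)
            + (ENNReal.ofReal (K * 2) * x) ^ (1 / 2 : ℝ)) := by
        rw [eLpNorm_sub_comm]
        gcongr
        exact (eLpNorm_two_le_rpow htail).trans
          (ENNReal.rpow_add_le_add_rpow _ _ (by norm_num) (by norm_num))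
    _ ≤ _ := by
        rw [← add_assoc, add_comm]
        gcongr

end LevyBasis

/-! ### Covariances and `η`-coefficients -/

lemma enorm_sub_le_lipConst_mul {n u : ℕ} (F : (Fin u → RSpace n) → ℝ) (x y : Fin u → RSpace n) :
    ‖F x - F y‖ₑ ≤ lipConst F * ∑ i, ‖x i - y i‖ₑ := by
  have h : ‖F x - F y‖ₑ / ∑ i, ‖x i - y i‖ₑ ≤ lipConst F :=
    le_iSup₂ (f := fun x y => ‖F x - F y‖ₑ / ∑ i, ‖x i - y i‖ₑ) x y
  by_cases h0 : ∑ i, ‖x i - y i‖ₑ = 0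
  · have hxy : x = y := by
      ext1 i
      have := (Finset.sum_eq_zero_iff.1 h0) i (Finset.mem_univ i)
      rwa [enorm_eq_zero, sub_eq_zero] at this
    simp [hxy]
  · exact (ENNReal.div_le_iff h0 (ENNReal.sum_ne_top.2 fun _ _ => enorm_ne_top)).1 h

lemma enorm_le_supNorm {n u : ℕ} (F : (Fin u → RSpace n) → ℝ) (x : Fin u → RSpace n) :
    ‖F x‖ₑ ≤ supNorm F :=
  le_iSup (fun x => ‖F x‖ₑ) x

lemma continuous_of_lipConst_lt_top {n u : ℕ} {F : (Fin u → RSpace n) → ℝ}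
    (hF : lipConst F < ∞) : Continuous F := by
  have h : LipschitzWith ((lipConst F).toNNReal * u) F := by
    intro x y
    rw [edist_eq_enorm_sub, edist_eq_enorm_sub]
    refine (enorm_sub_le_lipConst_mul F x y).trans ?_
    rw [ENNReal.coe_mul, ENNReal.coe_toNNReal hF.ne, mul_assoc]
    refine mul_le_mul_right ?_ _
    calc ∑ i, ‖x i - y i‖ₑ ≤ ∑ _i : Fin u, ‖x - y‖ₑ :=
          Finset.sum_le_sum fun i _ => by
            have := norm_le_pi_norm (x - y) i
            rw [← ofReal_norm, ← ofReal_norm]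
            exact ENNReal.ofReal_le_ofReal this
      _ = _ := by simp
  exact h.continuous

section Covariance

variable {Ω : Type*} [MeasurableSpace Ω] {P : Measure Ω} [IsProbabilityMeasure P]

lemma memLp_two_of_enorm_le {f : Ω → ℝ} (hf : AEMeasurable f P) {a : ℝ≥0∞} (ha : a ≠ ∞)
    (h : ∀ ω, ‖f ω‖ₑ ≤ a) : MemLp f 2 P :=
  MemLp.of_bound hf.aestronglyMeasurable a.toReal (ae_of_all _ fun ω => by
    rw [← toReal_enorm]; exact ENNReal.toReal_mono ha (h ω))

lemma enorm_covariance_le {f g : Ω → ℝ} (hf : MemLp f 2 P) (hg : MemLp g 2 P) {b : ℝ≥0∞}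
    (h : ∀ ω, ‖g ω‖ₑ ≤ b) : ‖cov[f, g; P]‖ₑ ≤ 2 * (b * ∫⁻ ω, ‖f ω‖ₑ ∂P) := by
  have hfm := hf.1.enorm
  have h1 : ‖P[f * g]‖ₑ ≤ b * ∫⁻ ω, ‖f ω‖ₑ ∂P := by
    refine (enorm_integral_le_lintegral_enorm _).trans ?_
    rw [← lintegral_const_mul'' _ hfm]
    refine lintegral_mono fun ω => ?_
    rw [Pi.mul_apply, enorm_mul, mul_comm]
    exact mul_le_mul_left (h ω) _
  have h2 : ‖P[f] * P[g]‖ₑ ≤ b * ∫⁻ ω, ‖f ω‖ₑ ∂P := by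
    rw [enorm_mul, mul_comm]
    refine mul_le_mul' ?_ (enorm_integral_le_lintegral_enorm _)
    refine (enorm_integral_le_lintegral_enorm _).trans ?_
    calc ∫⁻ ω, ‖g ω‖ₑ ∂P ≤ ∫⁻ _, b ∂P := lintegral_mono h
      _ = b := by simp
  rw [covariance_eq_sub hf hg, two_mul]
  exact (enorm_sub_le).trans (add_le_add h1 h2)

/-- Replacing both arguments by independent approximations bounds the covariance of Lipschitz
functionals by the approximation errors in mean. -/
lemma enorm_covariance_le_of_indepFun {n u v : ℕ} {X X' : Ω → Fin u → RSpace n}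
    {Y Y' : Ω → Fin v → RSpace n} (hX : AEMeasurable X P) (hX' : AEMeasurable X' P)
    (hY : AEMeasurable Y P) (hY' : AEMeasurable Y' P) (hind : IndepFun X' Y' P)
    {F : (Fin u → RSpace n) → ℝ} {G : (Fin v → RSpace n) → ℝ} (hF : F ∈ BddLipschitz n u)
    (hG : G ∈ BddLipschitz n v) {e : ℝ≥0∞} (hXe : ∀ a, ∫⁻ ω, ‖X ω a - X' ω a‖ₑ ∂P ≤ e)
    (hYe : ∀ b, ∫⁻ ω, ‖Y ω b - Y' ω b‖ₑ ∂P ≤ e) :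
    ‖cov[fun ω => F (X ω), fun ω => G (Y ω); P]‖ₑ
      ≤ 2 * e * (u * supNorm G * lipConst F + v * supNorm F * lipConst G) := by
  have hFm := (continuous_of_lipConst_lt_top hF.2).measurable
  have hGm := (continuous_of_lipConst_lt_top hG.2).measurable
  have mF : ∀ {Z : Ω → Fin u → RSpace n}, AEMeasurable Z P → MemLp (fun ω => F (Z ω)) 2 P :=
    fun hZ => memLp_two_of_enorm_le (hFm.comp_aemeasurable hZ) hF.1.ne fun ω =>
      enorm_le_supNorm F _
  have mG : ∀ {Z : Ω → Fin v → RSpace n}, AEMeasurable Z P → MemLp (fun ω => G (Z ω)) 2 P :=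
    fun hZ => memLp_two_of_enorm_le (hGm.comp_aemeasurable hZ) hG.1.ne fun ω =>
      enorm_le_supNorm G _
  have hlip : ∀ {k : ℕ} {H : (Fin k → RSpace n) → ℝ} {Z Z' : Ω → Fin k → RSpace n},
      lipConst H < ∞ → AEMeasurable Z P → AEMeasurable Z' P →
      (∀ a, ∫⁻ ω, ‖Z ω a - Z' ω a‖ₑ ∂P ≤ e) →
      ∫⁻ ω, ‖H (Z ω) - H (Z' ω)‖ₑ ∂P ≤ lipConst H * (k * e) := by
    intro k H Z Z' hH hZ hZ' he
    calc ∫⁻ ω, ‖H (Z ω) - H (Z' ω)‖ₑ ∂P ≤ ∫⁻ ω, lipConst H * ∑ i, ‖Z ω i - Z' ω i‖ₑ ∂P :=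
          lintegral_mono fun ω => enorm_sub_le_lipConst_mul H _ _
      _ = lipConst H * ∑ i, ∫⁻ ω, ‖Z ω i - Z' ω i‖ₑ ∂P := by
          rw [lintegral_const_mul' _ _ hH.ne, lintegral_finsetSum']
          intro i _
          exact (((measurable_pi_apply i).comp_aemeasurable hZ).sub
            ((measurable_pi_apply i).comp_aemeasurable hZ')).enorm
      _ ≤ lipConst H * ∑ _i : Fin k, e := by gcongr with i; exact he i
      _ = _ := by simp
  have h0 : cov[fun ω => F (X' ω), fun ω => G (Y' ω); P] = 0 :=
    (hind.comp hFm hGm).covariance_eq_zero (mF hX') (mG hY')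
  have hsplit : cov[fun ω => F (X ω), fun ω => G (Y ω); P]
      = cov[(fun ω => F (X ω)) - fun ω => F (X' ω), fun ω => G (Y ω); P]
        + cov[(fun ω => G (Y ω)) - fun ω => G (Y' ω), fun ω => F (X' ω); P] := by
    rw [covariance_comm ((fun ω => G (Y ω)) - fun ω => G (Y' ω)),
      covariance_sub_left (mF hX) (mF hX') (mG hY), covariance_sub_right (mF hX') (mG hY) (mG hY'),
      h0]
    ring
  rw [hsplit]
  refine (enorm_add_le _ _).trans ?_
  have h1 := enorm_covariance_le ((mF hX).sub (mF hX')) (mG hY) fun ω => enorm_le_supNorm G (Y ω)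
  have h2 := enorm_covariance_le ((mG hY).sub (mG hY')) (mF hX') fun ω => enorm_le_supNorm F (X' ω)
  have h3 := hlip hF.2 hX hX' hXe
  have h4 := hlip hG.2 hY hY' hYe
  calc _ ≤ 2 * (supNorm G * (lipConst F * (u * e))) + 2 * (supNorm F * (lipConst G * (v * e))) := by
        refine add_le_add (h1.trans ?_) (h2.trans ?_)
        · gcongr; exact h3
        · gcongr; exact h4
    _ = _ := by ring

/-- If the values at any two families of points at distance at least `h` can be approximated in
mean, with error `e`, by independent families, then `η(h) ≤ 2e`. -/
lemma eta_le_of_exists_indepFun {m n : ℕ} {X : RSpace m → Ω → RSpace n}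
    (hX : ∀ t, AEMeasurable (X t) P) {h : ℝ} {e : ℝ≥0∞}
    (H : ∀ (u v : ℕ) (Γ : Fin u → RSpace m) (Γ' : Fin v → RSpace m), SeparatedBy h Γ Γ' →
      ∃ (X' : Ω → Fin u → RSpace n) (Y' : Ω → Fin v → RSpace n),
        AEMeasurable X' P ∧ AEMeasurable Y' P ∧ IndepFun X' Y' P ∧
        (∀ a, ∫⁻ ω, ‖X (Γ a) ω - X' ω a‖ₑ ∂P ≤ e) ∧
        ∀ b, ∫⁻ ω, ‖X (Γ' b) ω - Y' ω b‖ₑ ∂P ≤ e) :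
    eta P X h ≤ 2 * e := by
  refine iSup₂_le fun u _ => iSup₂_le fun v _ => iSup₂_le fun F hF => iSup₂_le fun G hG =>
    iSup₂_le fun Γ Γ' => iSup_le fun hs => ENNReal.div_le_of_le_mul ?_
  obtain ⟨X', Y', hX', hY', hind, hXe, hYe⟩ := H u v Γ Γ' hs
  exact enorm_covariance_le_of_indepFun (X := fun ω a => X (Γ a) ω) (Y := fun ω b => X (Γ' b) ω)
    (aemeasurable_pi_lambda _ fun a => hX _) hX' (aemeasurable_pi_lambda _ fun b => hX _) hY'
    hind hF hG hXe hYe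

end Covariance

lemma HasExpDecayingEta.isEtaWeaklyDependent {Ω : Type*} [MeasurableSpace Ω] {m n : ℕ}
    {P : Measure Ω} {X : RSpace m → Ω → RSpace n} (h : HasExpDecayingEta P X) :
    IsEtaWeaklyDependent P X := by
  obtain ⟨C, c, hc, hC⟩ := h
  have h1 : Tendsto (fun h : ℝ => C * Real.exp (-c * h)) atTop (𝓝 0) := by
    have : Tendsto (fun h : ℝ => -c * h) atTop atBot :=
      tendsto_id.const_mul_atTop_of_neg (neg_neg_of_pos hc)
    simpa using (Real.tendsto_exp_atBot.comp this).const_mul C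
  have h2 := ENNReal.tendsto_ofReal h1
  rw [ENNReal.ofReal_zero] at h2
  exact tendsto_of_tendsto_of_tendsto_of_le_of_le' tendsto_const_nhds h2
    (Eventually.of_forall fun _ => zero_le)
    ((eventually_ge_atTop 0).mono fun h hh => hC h hh)

/-! ### Exponentially decaying kernels -/

lemma integrable_exp_neg_mul_norm {m : ℕ} {c : ℝ} (hc : 0 < c) :
    Integrable (fun x : RSpace m => Real.exp (-c * ‖x‖)) := by
  have h := integrable_one_add_norm (E := RSpace m) (μ := volume) (r := ((m + 1 : ℕ) : ℝ))
    (by simp)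
  refine (h.const_mul (((m + 1).factorial : ℝ) * Real.exp c / c ^ (m + 1))).mono' (by fun_prop)
    (ae_of_all _ fun x => ?_)
  have hx : 0 < 1 + ‖x‖ := by positivity
  have h1 := Real.pow_div_factorial_le_exp (c * (1 + ‖x‖)) (by positivity) (m + 1)
  rw [Real.norm_of_nonneg (Real.exp_pos _).le, Real.rpow_neg hx.le, Real.rpow_natCast, neg_mul,
    Real.exp_neg, ← div_eq_mul_inv, div_div, le_div_iff₀ (by positivity), inv_mul_le_iff₀
    (Real.exp_pos _)]
  rw [div_le_iff₀ (by positivity), mul_pow, mul_add, Real.exp_add, mul_one] at h1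
  linarith

lemma lintegral_shift {m : ℕ} {S : Type*} [MeasurableSpace S] (π : Measure S)
    [IsProbabilityMeasure π] {f : RSpace m → ℝ≥0∞} (hf : Measurable f) (t : RSpace m) :
    ∫⁻ p : S × RSpace m, f (t - p.2) ∂(π.prod volume) = ∫⁻ s, f s := by
  rw [(measurePreserving_snd (μ := π) (ν := (volume : Measure (RSpace m)))).lintegral_comp
    (f := fun s => f (t - s)) (hf.comp (measurable_const.sub measurable_id))]
  exact lintegral_sub_left_eq_self f t

section LevyBasis

variable {Ω S : Type*} [MeasurableSpace Ω] {P : Measure Ω} [MetricSpace S]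
  [MeasurableSpace S] [BorelSpace S]
  {m d n : ℕ} {L : Set (S × RSpace m) → Ω → RSpace d}
  {γ : RSpace d} {Sig : Matrix (Fin d) (Fin d) ℝ} {ν : Measure (RSpace d)} {π : Measure S}

/-- The theorem for kernels dominated by an exponential. The integral over a ball of radius `h / 2`
(in the maximum norm) around `t` approximates `X t` with exponentially small error, and such
balls around points at distance at least `h` are disjoint. -/
theorem movingAverageIsExpEta_of_frobSq_le [IsProbabilityMeasure P] (hL : IsLevyBasis P L)
    (hquad : HasCharacteristicQuadruplet P L γ Sig ν π)
    (hmoment : ∫⁻ x in {x | 1 < ‖x‖}, ENNReal.ofReal (‖x‖ ^ 2) ∂ν < ∞)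
    (hcentered : γ + ∫ x in {x | 1 < ‖x‖}, x ∂ν = 0)
    {g : RSpace m → Matrix (Fin n) (Fin d) ℝ} (hg : ∀ i j, Measurable fun t => g t i j)
    {M K : ℝ} (hM : 0 ≤ M) (hK : 0 < K) (hgM : ∀ t, frobSq (g t) ≤ M * Real.exp (-K * ‖t‖)) :
    MovingAverageIsExpEta P π L g := by
  have := hquad.isProbabilityMeasure
  have hmeas : ∀ t i j, Measurable fun p => shiftedKernel S g t p i j := fun t i j =>
    (hg i j).comp (measurable_const.sub measurable_snd)
  have hfin : ∀ t, ∫⁻ p, ENNReal.ofReal (frobSq (shiftedKernel S g t p)) ∂(π.prod volume) < ∞ := by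
    intro t
    refine (lintegral_shift π (measurable_frobSq_comp hg).ennreal_ofReal t).trans_lt ?_
    refine (lintegral_mono fun s => ENNReal.ofReal_le_ofReal (hgM s)).trans_lt ?_
    exact ((integrable_exp_neg_mul_norm hK).const_mul M).lintegral_lt_top
  refine ⟨fun t => ?_, fun X hX => ?_⟩
  · obtain ⟨-, Z, hZ, -, -⟩ := exists_tendsto_stochasticIntegral hL hquad hmoment hcentered
      (hmeas t) (hfin t)
    exact ⟨Z, hZ⟩
  suffices hexp : HasExpDecayingEta P X from ⟨hexp.isEtaWeaklyDependent, hexp⟩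
  obtain ⟨K₀, hK₀, happrox⟩ := exists_lintegral_norm_sub_integral_le hL hquad hmoment hcentered n
  have hJi := integrable_exp_neg_mul_norm (m := m) (half_pos hK)
  set J : ℝ := ∫ x : RSpace m, Real.exp (-(K / 2) * ‖x‖) with hJ
  have hJ0 : 0 ≤ J := integral_nonneg fun x => (Real.exp_pos _).le
  set R : ℝ := √(K₀ * (M * J)) with hR
  have hR0 : 0 ≤ R := Real.sqrt_nonneg _
  refine ⟨2 * (R + 1), K / 8, by positivity, fun h hh => ?_⟩
  let U : RSpace m → Set (S × RSpace m) := fun t => {p | ‖(t - p.2).ofLp‖ < h / 2}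
  have hU : ∀ t, MeasurableSet (U t) := fun t =>
    measurableSet_lt (((WithLp.measurable_ofLp 2 _).comp
      (measurable_const.sub measurable_snd)).norm) measurable_const
  have hUd : ∀ t t' : RSpace m, h ≤ ‖t.ofLp - t'.ofLp‖ → Disjoint (U t) (U t') := by
    intro t t' htt'
    refine Set.disjoint_left.2 fun p hp hp' => ?_
    have h3 : ‖(t - p.2).ofLp‖ < h / 2 := hp
    have h4 : ‖(t' - p.2).ofLp‖ < h / 2 := hp'
    have h1 : t.ofLp - t'.ofLp = (t - p.2).ofLp - (t' - p.2).ofLp := by simp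
    have h2 := norm_sub_le (t - p.2).ofLp (t' - p.2).ofLp
    rw [← h1] at h2
    linarith
  have htail : ∀ t, ENNReal.ofReal K₀ * ∫⁻ p in (U t)ᶜ,
      ENNReal.ofReal (frobSq (shiftedKernel S g t p)) ∂(π.prod volume)
        ≤ ENNReal.ofReal (R * Real.exp (-(K / 8) * h)) ^ (2 : ℝ) := by
    intro t
    have hpt : ∀ p ∈ (U t)ᶜ, ENNReal.ofReal (frobSq (shiftedKernel S g t p))
        ≤ ENNReal.ofReal (M * Real.exp (-(K / 4) * h))
          * ENNReal.ofReal (Real.exp (-(K / 2) * ‖t - p.2‖)) := by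
      intro p hp
      have hp1 : h / 2 ≤ ‖(t - p.2).ofLp‖ := not_lt.1 hp
      have hp2 : h / 2 ≤ ‖t - p.2‖ := hp1.trans ((pi_norm_le_iff_of_nonneg (norm_nonneg _)).2
        fun i => PiLp.norm_apply_le (t - p.2) i)
      rw [← ENNReal.ofReal_mul (by positivity)]
      refine ENNReal.ofReal_le_ofReal ((hgM _).trans ?_)
      rw [mul_assoc, ← Real.exp_add]
      gcongr
      nlinarith
    calc _ ≤ ENNReal.ofReal K₀ * ∫⁻ p, ENNReal.ofReal (M * Real.exp (-(K / 4) * h))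
          * ENNReal.ofReal (Real.exp (-(K / 2) * ‖t - p.2‖)) ∂(π.prod volume) := by
          refine mul_le_mul_right ?_ _
          exact (setLIntegral_mono' (hU t).compl hpt).trans (setLIntegral_le_lintegral _ _)
      _ = ENNReal.ofReal K₀ * (ENNReal.ofReal (M * Real.exp (-(K / 4) * h))
          * ENNReal.ofReal J) := by
          rw [lintegral_const_mul' _ _ ENNReal.ofReal_ne_top,
            lintegral_shift π (f := fun x => ENNReal.ofReal (Real.exp (-(K / 2) * ‖x‖)))
              (by fun_prop) t,
            ← ofReal_integral_eq_lintegral_ofReal hJi (ae_of_all _ fun x => (Real.exp_pos _).le)]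
      _ = _ := by
          rw [← ENNReal.ofReal_mul (by positivity), ← ENNReal.ofReal_mul hK₀.le, ENNReal.rpow_two,
            ← ENNReal.ofReal_pow (by positivity), mul_pow, hR, Real.sq_sqrt (by positivity),
            ← Real.exp_nat_mul]
          congr 1
          have : ((2 : ℕ) : ℝ) * (-(K / 8) * h) = -(K / 4) * h := by push_cast; ring
          rw [this]
          ring
  have hψ : ∀ t, ∃ ψ : SimpleKernel (S × RSpace m) n d,
      ∫⁻ ω, ‖X t ω - ψ.integral L (U t) ω‖ₑ ∂P
        ≤ ENNReal.ofReal ((R + 1) * Real.exp (-(K / 8) * h)) := by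
    intro t
    obtain ⟨ψ, hψ⟩ := happrox _ _ (hX t) (hfin t) (U t) (hU t)
      (ENNReal.ofReal (Real.exp (-(K / 8) * h))) (ENNReal.ofReal_pos.2 (Real.exp_pos _))
    refine ⟨ψ, hψ.trans ?_⟩
    rw [add_mul, one_mul, ENNReal.ofReal_add (by positivity) (by positivity)]
    gcongr
    calc _ ≤ (ENNReal.ofReal (R * Real.exp (-(K / 8) * h)) ^ (2 : ℝ)) ^ (1 / 2 : ℝ) := by
          gcongr
          exact htail t
      _ = _ := by rw [← ENNReal.rpow_mul]; norm_num
  choose ψ hψ using hψ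
  have h2 : (2 : ℝ≥0∞) = ENNReal.ofReal 2 := by simp
  rw [mul_assoc, ENNReal.ofReal_mul zero_le_two, ← h2]
  refine eta_le_of_exists_indepFun (fun t => (hX t).2.1) fun u v Γ Γ' hs =>
    ⟨fun ω a => (ψ (Γ a)).integral L (U (Γ a)) ω, fun ω b => (ψ (Γ' b)).integral L (U (Γ' b)) ω,
      aemeasurable_pi_lambda _ fun a => aemeasurable_integral hL _ (hU _),
      aemeasurable_pi_lambda _ fun b => aemeasurable_integral hL _ (hU _),
      indepFun_integral_of_disjoint hL hquad _ _ (fun a => hU _) (fun b => hU _)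
        fun a b => hUd _ _ (hs.2.2 a b), fun a => hψ _, fun b => hψ _⟩

end LevyBasis

/-! ### Decay of matrix exponentials -/

/-- A function on `[0, ∞)` that is bounded on a period and contracts from each period to the next
decays exponentially. -/
lemma exists_le_mul_exp_of_contraction {f : ℝ → ℝ} {N q D : ℝ} (hN : 0 < N) (hq : q < 1)
    (hD : ∀ t ∈ Set.Icc 0 N, f t ≤ D) (hf0 : ∀ t, 0 ≤ f t)
    (hf : ∀ t, 0 ≤ t → f (t + N) ≤ q * f t) :
    ∃ C c : ℝ, 0 ≤ C ∧ 0 < c ∧ ∀ t, 0 ≤ t → f t ≤ C * Real.exp (-c * t) := by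
  have hD0 : 0 ≤ D := (hf0 0).trans (hD 0 ⟨le_rfl, hN.le⟩)
  -- The contraction factor is made positive, so that it has a logarithm.
  set r : ℝ := max q (1 / 2) with hr
  have hr0 : 0 < r := lt_max_of_lt_right (by norm_num)
  have hr1 : r < 1 := max_lt hq (by norm_num)
  have hlog : Real.log r < 0 := Real.log_neg hr0 hr1
  have hiter : ∀ (k : ℕ) (s : ℝ), 0 ≤ s → f (s + k * N) ≤ r ^ k * f s := by
    intro k s hs
    induction k with
    | zero => simp
    | succ k ih =>
      have h1 := hf (s + k * N) (by positivity)
      have h2 : s + ((k + 1 : ℕ) : ℝ) * N = s + k * N + N := by push_cast; ring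
      rw [h2]
      calc f (s + k * N + N) ≤ q * f (s + k * N) := h1
        _ ≤ r * f (s + k * N) := mul_le_mul_of_nonneg_right (le_max_left _ _) (hf0 _)
        _ ≤ r * (r ^ k * f s) := by gcongr
        _ = _ := by ring
  refine ⟨D / r, -Real.log r / N, by positivity, div_pos (neg_pos.2 hlog) hN, fun t ht => ?_⟩
  set k : ℕ := ⌊t / N⌋₊
  have hk1 : (k : ℝ) ≤ t / N := Nat.floor_le (by positivity)
  have hk2 : t / N < k + 1 := Nat.lt_floor_add_one _
  rw [le_div_iff₀ hN] at hk1
  rw [div_lt_iff₀ hN] at hk2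
  have hs : t - k * N ∈ Set.Icc 0 N := ⟨by linarith, by linarith⟩
  have h1 := hiter k (t - k * N) hs.1
  rw [sub_add_cancel] at h1
  have h2 : r ^ k ≤ r⁻¹ * Real.exp (-(-Real.log r / N) * t) := by
    rw [← Real.rpow_natCast, Real.rpow_def_of_pos hr0, ← Real.exp_log (inv_pos.2 hr0),
      ← Real.exp_add, Real.log_inv]
    refine Real.exp_le_exp.2 ?_
    have h3 : -(-Real.log r / N) * t = Real.log r * (t / N) := by ring
    have h4 : t / N ≤ k + 1 := by rw [div_le_iff₀ hN]; exact hk2.le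
    rw [h3]
    nlinarith
  calc f t ≤ r ^ k * f (t - k * N) := h1
    _ ≤ (r⁻¹ * Real.exp (-(-Real.log r / N) * t)) * D := by
        gcongr
        · exact hf0 _
        · exact hD _ hs
    _ = _ := by ring

/-- If the spectral radius of `exp a` is less than `1`, the semigroup `exp (t a)` decays
exponentially: by Gelfand's formula some power of `exp a` is a contraction. -/
lemma exists_norm_exp_smul_le {𝔸 : Type*} [NormedRing 𝔸] [NormedAlgebra ℂ 𝔸] [CompleteSpace 𝔸]
    (a : 𝔸) (ha : spectralRadius ℂ (NormedSpace.exp a) < 1) :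
    ∃ C c : ℝ, 0 ≤ C ∧ 0 < c ∧ ∀ t : ℝ, 0 ≤ t →
      ‖NormedSpace.exp ((t : ℂ) • a)‖ ≤ C * Real.exp (-c * t) := by
  let _ : NormedAlgebra ℚ 𝔸 := NormedAlgebra.restrictScalars ℚ ℂ 𝔸
  obtain ⟨N, hN1, hN⟩ : ∃ N : ℕ, 1 ≤ N ∧ ‖NormedSpace.exp a ^ N‖ < 1 := by
    have h := spectrum.pow_norm_pow_one_div_tendsto_nhds_spectralRadius (NormedSpace.exp a)
    obtain ⟨N, hN, hN1⟩ := ((h.eventually_lt_const ha).and (eventually_ge_atTop 1)).exists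
    refine ⟨N, hN1, ?_⟩
    by_contra hcon
    refine absurd hN (not_lt.2 ?_)
    rw [← ENNReal.ofReal_one]
    exact ENNReal.ofReal_le_ofReal (Real.one_le_rpow (not_lt.1 hcon) (by positivity))
  have hcont : Continuous fun t : ℝ => ‖NormedSpace.exp ((t : ℂ) • a)‖ :=
    (NormedSpace.exp_continuous.comp (Complex.continuous_ofReal.smul continuous_const)).norm
  obtain ⟨D, hD⟩ := (isCompact_Icc (a := (0 : ℝ)) (b := N)).exists_bound_of_continuousOn
    hcont.continuousOn
  refine exists_le_mul_exp_of_contraction (N := N) (q := ‖NormedSpace.exp a ^ N‖) (D := D)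
    (by exact_mod_cast hN1) hN (fun t ht => ?_) (fun t => norm_nonneg _) fun t _ => ?_
  · simpa using hD t ht
  · have h1 : (((t + N : ℝ)) : ℂ) • a = N • a + (t : ℂ) • a := by
      push_cast
      rw [add_smul, add_comm, ← Nat.cast_smul_eq_nsmul ℂ]
    rw [h1, NormedSpace.exp_add_of_commute, NormedSpace.exp_nsmul]
    · exact norm_mul_le _ _
    · exact ((Commute.refl a).smul_right _).smul_left N

open scoped Matrix.Norms.Operator in
/-- Every eigenvalue of `exp A` is the exponential of an eigenvalue of `A`: the eigenspace is
invariant under `A`, which has an eigenvector in it. -/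
lemma exists_mem_spectrum_of_mem_spectrum_exp {p : ℕ} (A : Matrix (Fin p) (Fin p) ℂ) {μ : ℂ}
    (hμ : μ ∈ spectrum ℂ (NormedSpace.exp A)) :
    ∃ w ∈ spectrum ℂ A, Complex.exp w = μ := by
  rw [← Matrix.spectrum_toLin'] at hμ
  have hE := Module.End.HasEigenvalue.of_mem_spectrum hμ
  set E := Module.End.eigenspace (Matrix.toLin' (NormedSpace.exp A)) μ with hEdef
  have hcomm : Commute A (NormedSpace.exp A) := (Commute.refl A).exp_right
  have hmaps : ∀ v ∈ E, Matrix.toLin' A v ∈ E := by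
    intro v hv
    rw [hEdef, Module.End.mem_eigenspace_iff] at hv ⊢
    simp only [Matrix.toLin'_apply] at hv ⊢
    rw [Matrix.mulVec_mulVec, ← hcomm.eq, ← Matrix.mulVec_mulVec, hv, Matrix.mulVec_smul]
  have : Nontrivial E := Submodule.nontrivial_iff_ne_bot.2 hE
  obtain ⟨w, hw⟩ := Module.End.exists_eigenvalue ((Matrix.toLin' A).restrict hmaps)
  obtain ⟨v, hv⟩ := hw.exists_hasEigenvector
  have hv0 : (v : Fin p → ℂ) ≠ 0 := fun h => hv.2 (Subtype.ext h)
  have hAv : A.mulVec v = w • (v : Fin p → ℂ) := by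
    have := congrArg Subtype.val hv.apply_eq_smul
    simpa using this
  have hexpv : (NormedSpace.exp A).mulVec v = μ • (v : Fin p → ℂ) := by
    have := Module.End.mem_eigenspace_iff.1 v.2
    simpa using this
  refine ⟨w, ?_, ?_⟩
  · rw [← Matrix.spectrum_toLin']
    exact (Module.End.hasEigenvalue_of_hasEigenvector (x := (v : Fin p → ℂ))
      ⟨Module.End.mem_eigenspace_iff.2 (by simpa using hAv), hv0⟩).mem_spectrum
  · have hpow : ∀ k : ℕ, (A ^ k).mulVec v = w ^ k • (v : Fin p → ℂ) := by
      intro k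
      induction k with
      | zero => simp
      | succ k ih =>
        rw [pow_succ, ← Matrix.mulVec_mulVec, hAv, Matrix.mulVec_smul, ih, smul_smul, pow_succ,
          mul_comm]
    have h1 := (NormedSpace.exp_series_hasSum_exp' (𝕂 := ℂ) A).map
      (Matrix.mulVecBilin ℂ ℂ |>.flip (v : Fin p → ℂ)) (by
        exact continuous_id.matrix_mulVec continuous_const)
    have h2 := (NormedSpace.exp_series_hasSum_exp' (𝕂 := ℂ) w).smul_const (v : Fin p → ℂ)
    have h3 := h1.unique (h2.congr_fun fun k => by
      simp [hpow, smul_smul])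
    rw [← Complex.exp_eq_exp_ℂ] at h3
    have h4 : μ • (v : Fin p → ℂ) = Complex.exp w • (v : Fin p → ℂ) := by
      rw [← hexpv]; exact h3
    exact (smul_left_injective ℂ hv0 h4).symm

open scoped Matrix.Norms.Operator in
/-- The semigroup `exp (t A)` decays exponentially if all complex eigenvalues of the real matrix `A`
have negative real part. -/
lemma exists_norm_exp_smul_le_of_spectrum {p : ℕ} (A : Matrix (Fin p) (Fin p) ℝ)
    (hA : ∀ w ∈ spectrum ℂ (A.map (algebraMap ℝ ℂ)), w.re < 0) :
    ∃ C c : ℝ, 0 ≤ C ∧ 0 < c ∧ ∀ t : ℝ, 0 ≤ t →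
      ‖NormedSpace.exp (t • A)‖ ≤ C * Real.exp (-c * t) := by
  have hr : spectralRadius ℂ (NormedSpace.exp (A.map (algebraMap ℝ ℂ))) < 1 := by
    rcases isEmpty_or_nonempty (Fin p) with hp | hp
    · rw [spectrum.SpectralRadius.of_subsingleton]
      exact one_pos
    · have : Nontrivial (Matrix (Fin p) (Fin p) ℂ) := inferInstance
      have h := spectrum.spectralRadius_lt_of_forall_lt
        (NormedSpace.exp (A.map (algebraMap ℝ ℂ))) (r := 1) fun μ hμ => by
          obtain ⟨w, hw, rfl⟩ := exists_mem_spectrum_of_mem_spectrum_exp _ hμ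
          rw [← NNReal.coe_lt_coe, coe_nnnorm, Complex.norm_exp, NNReal.coe_one]
          exact Real.exp_lt_one_iff.2 (hA w hw)
      simpa using h
  obtain ⟨C, c, hC, hc, h⟩ := exists_norm_exp_smul_le _ hr
  refine ⟨C, c, hC, hc, fun t ht => le_trans (le_of_eq ?_) (h t ht)⟩
  have hmap : (NormedSpace.exp (t • A)).map (algebraMap ℝ ℂ)
      = NormedSpace.exp ((t : ℂ) • A.map (algebraMap ℝ ℂ)) := by
    have h1 := NormedSpace.map_exp (algebraMap ℝ ℂ).mapMatrix
      (continuous_id.matrix_map (continuous_algebraMap ℝ ℂ)) (t • A)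
    simp only [RingHom.mapMatrix_apply] at h1
    refine h1.trans (congrArg NormedSpace.exp ?_)
    ext i j
    simp
  refine Eq.trans ?_ (congrArg norm hmap)
  rw [Matrix.linfty_opNorm_def, Matrix.linfty_opNorm_def]
  simp

/-! ### Causal and isotropic kernels -/

lemma exists_pos_forall_le {ι : Type*} [Finite ι] {c : ι → ℝ} (hc : ∀ k, 0 < c k) :
    ∃ c₀, 0 < c₀ ∧ ∀ k, c₀ ≤ c k := by
  have h : ∀ᶠ c₀ in 𝓝[>] (0 : ℝ), ∀ k, c₀ ≤ c k :=
    eventually_all.2 fun k => mem_of_superset (Ioo_mem_nhdsGT (hc k)) fun _ hx => hx.2.le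
  obtain ⟨c₀, h1, h2⟩ := (h.and self_mem_nhdsWithin).exists
  exact ⟨c₀, h2, h1⟩

lemma norm_le_sum_of_nonneg {m : ℕ} {t : RSpace m} (ht : ∀ k, 0 ≤ t k) : ‖t‖ ≤ ∑ k, t k := by
  have h0 : 0 ≤ ∑ k, t k := Finset.sum_nonneg fun k _ => ht k
  refine le_of_sq_le_sq ?_ h0
  rw [EuclideanSpace.norm_sq_eq]
  simp only [Real.norm_eq_abs, sq_abs]
  exact Finset.sum_sq_le_sq_sum_of_nonneg fun k _ => ht k

open scoped Matrix.Norms.Operator in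
lemma frobSq_le_linfty_opNorm_sq {n d : ℕ} (A : Matrix (Fin n) (Fin d) ℝ) :
    frobSq A ≤ n * d * ‖A‖ ^ 2 := by
  have hentry : ∀ i j, |A i j| ≤ ‖A‖ := by
    intro i j
    rw [← Real.norm_eq_abs, ← coe_nnnorm, ← coe_nnnorm, NNReal.coe_le_coe,
      Matrix.linfty_opNNNorm_def]
    exact (Finset.single_le_sum (f := fun j => ‖A i j‖₊) (fun _ _ => zero_le)
      (Finset.mem_univ j)).trans (Finset.le_sup (f := fun i => ∑ j, ‖A i j‖₊) (Finset.mem_univ i))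
  calc frobSq A ≤ ∑ _i : Fin n, ∑ _j : Fin d, ‖A‖ ^ 2 := by
        refine Finset.sum_le_sum fun i _ => Finset.sum_le_sum fun j _ => ?_
        rw [← sq_abs]
        gcongr
        exact hentry i j
    _ = _ := by simp [mul_assoc]

/-- A bound on a product in a normed ring that need not satisfy `‖1‖ = 1`; the ring of `0 × 0`
matrices does not. -/
lemma norm_list_prod_le_norm_one_mul {R : Type*} [NormedRing R] (l : List R) :
    ‖l.prod‖ ≤ ‖(1 : R)‖ * (l.map norm).prod := by
  induction l with
  | nil => simp
  | cons a l ih =>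
    rw [List.prod_cons, List.map_cons, List.prod_cons]
    calc ‖a * l.prod‖ ≤ ‖a‖ * ‖l.prod‖ := norm_mul_le _ _
      _ ≤ ‖a‖ * (‖(1 : R)‖ * (l.map norm).prod) := by gcongr
      _ = _ := by ring

open scoped Matrix.Norms.Operator in
lemma measurable_causalKernel_apply {m n d p : ℕ} (A : Fin m → Matrix (Fin p) (Fin p) ℝ)
    (B : Matrix (Fin n) (Fin p) ℝ) (C : Matrix (Fin p) (Fin d) ℝ) (i : Fin n) (j : Fin d) :
    Measurable fun t : RSpace m => causalKernel A B C t i j := by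
  classical
  have hset : MeasurableSet {t : RSpace m | ∀ k, 0 ≤ t k} := by
    rw [Set.ofPred_forall]
    exact MeasurableSet.iInter fun k => measurableSet_le measurable_const (by fun_prop)
  have hexp : ∀ k, Continuous fun t : RSpace m => NormedSpace.exp (t k • A k) := fun k =>
    NormedSpace.exp_continuous.comp
      (Continuous.smul (by fun_prop : Continuous fun t : RSpace m => t k) continuous_const)
  have hprod : Continuous fun t : RSpace m =>
      (List.ofFn fun k => NormedSpace.exp (t k • A k)).prod := by
    simp_rw [List.ofFn_eq_map]
    exact continuous_list_prod _ fun k _ => hexp k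
  have hcont : Continuous fun t : RSpace m =>
      (B * (List.ofFn fun k => NormedSpace.exp (t k • A k)).prod * C) i j :=
    ((continuous_const.matrix_mul hprod).matrix_mul continuous_const).matrix_elem i j
  have h : ∀ t : RSpace m, causalKernel A B C t i j
      = {t : RSpace m | ∀ k, 0 ≤ t k}.indicator
        (fun t => (B * (List.ofFn fun k => NormedSpace.exp (t k • A k)).prod * C) i j) t := by
    intro t
    by_cases ht : ∀ k, 0 ≤ t k
    · simp [causalKernel, ht]
    · simp [causalKernel, ht]
  simp_rw [h]
  exact hcont.measurable.indicator hset

open scoped Matrix.Norms.Operator in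
lemma exists_frobSq_causalKernel_le {m n d p : ℕ} (A : Fin m → Matrix (Fin p) (Fin p) ℝ)
    (B : Matrix (Fin n) (Fin p) ℝ) (C : Matrix (Fin p) (Fin d) ℝ)
    (hA : ∀ k, ∀ w ∈ spectrum ℂ ((A k).map (algebraMap ℝ ℂ)), w.re < 0) :
    ∃ M K : ℝ, 0 ≤ M ∧ 0 < K ∧
      ∀ t : RSpace m, frobSq (causalKernel A B C t) ≤ M * Real.exp (-K * ‖t‖) := by
  choose D c hD hc hDc using fun k => exists_norm_exp_smul_le_of_spectrum (A k) (hA k)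
  obtain ⟨c₀, hc₀, hc₀c⟩ := exists_pos_forall_le hc
  set R : ℝ := ‖B‖ * (‖(1 : Matrix (Fin p) (Fin p) ℝ)‖ * ∏ k, D k) * ‖C‖ with hR
  have hDprod : 0 ≤ ∏ k, D k := Finset.prod_nonneg fun k _ => hD k
  refine ⟨n * d * R ^ 2, 2 * c₀, by positivity, by positivity, fun t => ?_⟩
  by_cases ht : ∀ k, 0 ≤ t k
  · set Q := (List.ofFn fun k => NormedSpace.exp (t k • A k)).prod with hQ
    have hker : causalKernel A B C t = B * Q * C := by simp [causalKernel, ht, hQ]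
    have hQle : ‖Q‖ ≤ ‖(1 : Matrix (Fin p) (Fin p) ℝ)‖ * (∏ k, D k) * Real.exp (-c₀ * ‖t‖) := by
      calc ‖Q‖ ≤ ‖(1 : Matrix (Fin p) (Fin p) ℝ)‖ * ∏ k, ‖NormedSpace.exp (t k • A k)‖ := by
            have h := norm_list_prod_le_norm_one_mul
              (List.ofFn fun k => NormedSpace.exp (t k • A k))
            rwa [List.map_ofFn, List.prod_ofFn] at h
        _ ≤ ‖(1 : Matrix (Fin p) (Fin p) ℝ)‖ * ∏ k, D k * Real.exp (-c₀ * t k) := by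
            gcongr with k
            refine (hDc k (t k) (ht k)).trans ?_
            gcongr
            · exact hD k
            · exact ht k
            · exact hc₀c k
        _ = ‖(1 : Matrix (Fin p) (Fin p) ℝ)‖ * (∏ k, D k) * Real.exp (-c₀ * ∑ k, t k) := by
            rw [Finset.prod_mul_distrib, ← Real.exp_sum, Finset.mul_sum, mul_assoc]
        _ ≤ _ := by
            gcongr ?_ * Real.exp ?_
            rw [neg_mul, neg_mul, neg_le_neg_iff]
            gcongr
            exact norm_le_sum_of_nonneg ht
    have hnorm : ‖B * Q * C‖ ≤ R * Real.exp (-c₀ * ‖t‖) := by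
      calc ‖B * Q * C‖ ≤ ‖B * Q‖ * ‖C‖ := Matrix.linfty_opNorm_mul _ _
        _ ≤ (‖B‖ * ‖Q‖) * ‖C‖ := by gcongr; exact Matrix.linfty_opNorm_mul _ _
        _ ≤ (‖B‖ * (‖(1 : Matrix (Fin p) (Fin p) ℝ)‖ * (∏ k, D k) * Real.exp (-c₀ * ‖t‖)))
            * ‖C‖ := by gcongr
        _ = _ := by rw [hR]; ring
    calc frobSq (causalKernel A B C t) ≤ n * d * ‖B * Q * C‖ ^ 2 := by
          rw [hker]; exact frobSq_le_linfty_opNorm_sq _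
      _ ≤ n * d * (R * Real.exp (-c₀ * ‖t‖)) ^ 2 := by gcongr
      _ = _ := by
          have h2 : -(2 * c₀) * ‖t‖ = ((2 : ℕ) : ℝ) * (-c₀ * ‖t‖) := by push_cast; ring
          rw [mul_pow, h2, Real.exp_nat_mul]
          ring
  · have hker : causalKernel A B C t = 0 := by simp [causalKernel, ht]
    rw [hker, frobSq_zero]
    positivity

lemma measurable_isotropicKernel_apply {m n d p : ℕ} (c : Fin p → Matrix (Fin n) (Fin d) ℂ)
    (z : Fin p → ℂ) (i : Fin n) (j : Fin d) :
    Measurable fun t : RSpace m => isotropicKernel c z t i j := by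
  simp only [isotropicKernel, Matrix.of_apply]
  fun_prop

lemma exists_frobSq_isotropicKernel_le {m n d p : ℕ} (c : Fin p → Matrix (Fin n) (Fin d) ℂ)
    (z : Fin p → ℂ) (hz : ∀ r, (z r).re < 0) :
    ∃ M K : ℝ, 0 ≤ M ∧ 0 < K ∧
      ∀ t : RSpace m, frobSq (isotropicKernel c z t) ≤ M * Real.exp (-K * ‖t‖) := by
  obtain ⟨c₀, hc₀, hc₀z⟩ := exists_pos_forall_le (c := fun r => -(z r).re)
    fun r => neg_pos.2 (hz r)
  refine ⟨∑ i, ∑ j, (∑ r, ‖c r i j‖) ^ 2, 2 * c₀,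
    Finset.sum_nonneg fun _ _ => Finset.sum_nonneg fun _ _ => sq_nonneg _, by positivity,
    fun t => ?_⟩
  have h2 : Real.exp (-(2 * c₀) * ‖t‖) = Real.exp (-c₀ * ‖t‖) ^ 2 := by
    rw [← Real.exp_nat_mul]
    congr 1
    push_cast
    ring
  rw [h2, frobSq, Finset.sum_mul]
  refine Finset.sum_le_sum fun i _ => ?_
  rw [Finset.sum_mul]
  refine Finset.sum_le_sum fun j _ => ?_
  rw [← mul_pow, ← sq_abs]
  gcongr
  rw [isotropicKernel, Matrix.of_apply, Finset.sum_mul]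
  refine (Complex.abs_re_le_norm _).trans ((norm_sum_le _ _).trans ?_)
  refine Finset.sum_le_sum fun r _ => ?_
  rw [norm_mul, Complex.norm_exp, Complex.re_mul_ofReal]
  gcongr
  linarith [hc₀z r]

end LevyField

theorem theorem3p22 {Ω S : Type*} [MeasurableSpace Ω] (P : Measure Ω) [IsProbabilityMeasure P]
    [MetricSpace S] [CompleteSpace S] [SecondCountableTopology S] [MeasurableSpace S]
    [BorelSpace S] {m d : ℕ} (L : Set (S × LevyField.RSpace m) → Ω → LevyField.RSpace d)
    (γ : LevyField.RSpace d) (Sig : Matrix (Fin d) (Fin d) ℝ)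
    (ν : Measure (LevyField.RSpace d)) (π : Measure S)
    (hL : LevyField.IsLevyBasis P L)
    (hquad : LevyField.HasCharacteristicQuadruplet P L γ Sig ν π)
    (hmoment : ∫⁻ x in {x | 1 < ‖x‖}, ENNReal.ofReal (‖x‖ ^ 2) ∂ν < ∞)
    (hcentered : γ + ∫ x in {x | 1 < ‖x‖}, x ∂ν = 0) {n : ℕ} :
    (∀ g : LevyField.RSpace m → Matrix (Fin n) (Fin d) ℝ, (∀ i j, Measurable fun t => g t i j) →
      (∃ M K : ℝ, 0 ≤ M ∧ 0 < K ∧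
        ∀ t, LevyField.frobNorm (g t) ^ 2 ≤ M * Real.exp (-K * ‖t‖)) →
      LevyField.MovingAverageIsExpEta P π L g) ∧
    (∀ (p : ℕ) (A : Fin m → Matrix (Fin p) (Fin p) ℝ) (B : Matrix (Fin n) (Fin p) ℝ)
      (C : Matrix (Fin p) (Fin d) ℝ),
      (∀ k, ∀ w ∈ spectrum ℂ ((A k).map (algebraMap ℝ ℂ)), w.re < 0) →
      LevyField.MovingAverageIsExpEta P π L (LevyField.causalKernel A B C)) ∧
    (∀ (p : ℕ) (c : Fin p → Matrix (Fin n) (Fin d) ℂ) (z : Fin p → ℂ), (∀ r, (z r).re < 0) →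
      LevyField.MovingAverageIsExpEta P π L (LevyField.isotropicKernel c z)) := by
  have main : ∀ g : LevyField.RSpace m → Matrix (Fin n) (Fin d) ℝ,
      (∀ i j, Measurable fun t => g t i j) →
      (∃ M K : ℝ, 0 ≤ M ∧ 0 < K ∧ ∀ t, LevyField.frobSq (g t) ≤ M * Real.exp (-K * ‖t‖)) →
      LevyField.MovingAverageIsExpEta P π L g := by
    rintro g hg ⟨M, K, hM, hK, hgM⟩
    exact LevyField.movingAverageIsExpEta_of_frobSq_le hL hquad hmoment hcentered hg hM hK hgM
  refine ⟨fun g hg hgM => main g hg ?_, fun p A B C hA => ?_, fun p c z hz => ?_⟩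
  · simpa only [LevyField.frobNorm_sq] using hgM
  · exact main _ (LevyField.measurable_causalKernel_apply A B C)
      (LevyField.exists_frobSq_causalKernel_le A B C hA)
  · exact main _ (LevyField.measurable_isotropicKernel_apply c z)
      (LevyField.exists_frobSq_isotropicKernel_le c z hz)
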